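/- **Setting.** There are $n$ agents. Agent $i$ has a value $v_i\ge 0$ for being served, drawn independently from a distribution function $F_i$ on $[0,\infty)$; a set of agents may be served together iff it is independent in a given matroid on $[n]$. Write $F_i^{-1}(t)=\sup\{v\ge 0: F_i(v)\le t\}\in[0,\infty]$ (with $\sup\emptyset=0$; a price $\infty$ is never accepted, and $0\cdot\infty=0$). *Myerson's mechanism* for given non-decreasing functions $\phi_i:[0,\infty)\to[-\infty,\infty)$ serves, at values $v$, a feasible set $S$ maximizing $\sum_{i\in S}\phi_i(v_i)$, ties being broken by an arbitrary fixed priority order on sets of agents; unserved agents pay $0$ and a served agent $i$ pays the infimum of the values $z\ge0$ at which it would still be served (the other values being fixed). Let $q_i$ be the probability that it serves agent $i$ and $\mathcal R^{\mathrm{Mye}}$ its expected revenue. A *sequential posted-price mechanism* with an ordering of the agents and prices $p_i$ starts from $A=\emptyset$ and goes through the agents in order; agent $i$ is offered the price $p_i$ iff $A\cup\{i\}$ is feasible, and if $v_i\ge p_i$ the agent accepts, pays $p_i$ and is added to $A$. **Theorem.** (1) (Regular case.) Suppose that each $F_i$ has a density $f_i$ and is regular, i.e. the virtual value $\phi_i(v)=v-\frac{1-F_i(v)}{f_i(v)}$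 is non-decreasing on $[0,\infty)$ (with $\phi_i(v)=-\infty$ if $f_i(v)=0$ and $F_i(v)<1$, and $\phi_i(v)=v$ if $F_i(v)=1$). Let Myerson's mechanism be run with these $\phi_i$, and let $p_i=F_i^{-1}(1-q_i)$. Then the sequential posted-price mechanism with prices $p_i$ that approaches the agents in decreasing order of $p_i$ (ties in any order) has expected revenue at least $\frac12\mathcal R^{\mathrm{Mye}}$. (2) (General case.) Let the $F_i$ be arbitrary, possibly with point masses, with $v\cdot\Pr[v_i\ge v]\to0$ as $v\to\infty$ (for instance $\mathbb E[v_i]<\infty$). Let $R_i(q)=q\,F_i^{-1}(1-q)$ for $q\in[0,1]$ (so $R_i(0)=0$) be the revenue curve, $\bar R_i$ its least concave majorant on $[0,1]$, and let Myerson's mechanism be run with the ironed virtual values $\bar\phi_i(v)=\bar R_i'(1-F_i(v))$ (right derivative; $-\infty$ if $F_i(v)=0$). Then for every $i$ there are numbers $x_i\in[0,1]$ and $0\le\overline q_i\le q_i\le\underline q_i\le1$ with $x_i\underline q_i+(1-x_i)\overline q_i=q_i$, such that with $\underline p_i=F_i^{-1}(1-\underline q_i)$ and $\overline p_i=F_i^{-1}(1-\overline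 q_i)$ the following hold. - $\bar\phi_i$ is constant on $(\underline p_i,\overline p_i)$, and $\underline q_i=\overline q_i=q_i$ whenever $R_i$ is concave. - Consider the sequential posted-price mechanism in which, independently for each $i$, the price $\underline p_i$ is chosen with probability $x_i$ and $\overline p_i$ with probability $1-x_i$; a chosen price $p=F_i^{-1}(1-q)$, $q\in\{\underline q_i,\overline q_i\}$, is actually offered with probability $q/\Pr[v_i\ge p]$ (which is $1$ if $F_i$ has no point masses and $q>0$) and otherwise no offer is made to $i$; and the agents are approached in decreasing order of $p_i=\bigl(x_i\underline p_i\underline q_i+(1-x_i)\overline p_i\overline q_i\bigr)/q_i$ (with $p_i=0$ if $q_i=0$; ties in any order). Its expected revenue is at least $\frac12\mathcal R^{\mathrm{Mye}}$. -/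

import Mathlib

open MeasureTheory ProbabilityTheory Set Filter Topology
open scoped ENNReal NNReal

noncomputable section

namespace BSMD

/-! ### Value distributions

A value distribution is a probability measure on `ℝ` that gives no mass to negative values. Prices
live in `[0, ∞]`; the price `∞` is never accepted. -/

/-- The generalized inverse `F⁻¹(t) = sup {v : F(v) ≤ t}` of the distribution function `F` of `μ`,
as a price in `[0, ∞]`. It is the ordinary inverse where `F` is strictly increasing;
`F⁻¹(0)` is the lower end of the support, and `F⁻¹(1) = ∞`. -/
def quantile (μ : Measure ℝ) (t : ℝ) : ℝ≥0∞ :=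
  ⨆ (v : ℝ) (_ : cdf μ v ≤ t), ENNReal.ofReal v

/-- The probability that an agent with value distribution `μ` accepts the price `p`. -/
def acceptProb (μ : Measure ℝ) (p : ℝ≥0∞) : ℝ :=
  μ.real {v | p ≤ ENNReal.ofReal v}

/-- The virtual value `φ(v) = v - (1 - F(v)) / f(v)` of a distribution `μ` with density `f`.
The quotient is taken in `[0, ∞]`: where `f(v) = 0` and `F(v) < 1` the virtual value is `-∞`,
and where `F(v) = 1` it is `v`. -/
def virtualValue (μ : Measure ℝ) (f : ℝ → ℝ≥0) (v : ℝ) : EReal :=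
  (v : EReal) - ((ENNReal.ofReal (1 - cdf μ v) / (f v : ℝ≥0∞) : ℝ≥0∞) : EReal)

/-- Regularity: the virtual value is non-decreasing (on the possible values `v ≥ 0`). -/
def IsRegular (μ : Measure ℝ) (f : ℝ → ℝ≥0) : Prop :=
  MonotoneOn (virtualValue μ f) (Ici 0)

/-- The revenue curve `R(q) = q · F⁻¹(1 - q)` on `[0, 1]`, with `R(0) = 0`. -/
def revenueCurve (μ : Measure ℝ) (q : ℝ) : ℝ :=
  q * (quantile μ (1 - q)).toReal

/-- The ironed revenue curve: the least concave majorant on `[0, 1]` of the revenue curve. -/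
def ironedRevenueCurve (μ : Measure ℝ) (q : ℝ) : ℝ :=
  sInf {y | ∃ g : ℝ → ℝ, ConcaveOn ℝ (Icc 0 1) g ∧
    (∀ r ∈ Icc (0 : ℝ) 1, revenueCurve μ r ≤ g r) ∧ g q = y}

/-- The ironed virtual value of `v`: the right derivative of the ironed revenue curve at
`1 - F(v)`, that is, the supremum of the slopes of its chords to the right
(the curve is concave). It is `-∞` where `F(v) = 0`. -/
def ironedVirtualValue (μ : Measure ℝ) (v : ℝ) : EReal :=
  ⨆ r ∈ Ioc (1 - cdf μ v) 1,
    (((ironedRevenueCurve μ r - ironedRevenueCurve μ (1 - cdf μ v)) /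
      (r - (1 - cdf μ v)) : ℝ) : EReal)

/-! ### Myerson's mechanism -/

variable {n : ℕ}

open Classical in
/-- The feasible sets of agents: the independent sets of the matroid. -/
def feasible (J : Matroid (Fin n)) : Finset (Finset (Fin n)) :=
  Finset.univ.filter fun S => J.Indep (S : Set (Fin n))

/-- The (ironed) virtual surplus of the set `S`, for the (ironed) virtual value functions `φ`. -/
def virtualSurplus (φ : Fin n → ℝ → EReal) (S : Finset (Fin n)) (v : Fin n → ℝ) : EReal :=
  ∑ i ∈ S, φ i (v i)

theorem exists_myersonAlloc (J : Matroid (Fin n)) (φ : Fin n → ℝ → EReal)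
    (τ : Finset (Fin n) ↪ ℕ) (v : Fin n → ℝ) :
    ∃ S ∈ feasible J, ∀ T ∈ feasible J,
      toLex (virtualSurplus φ T v, τ T) ≤ toLex (virtualSurplus φ S v, τ S) :=
  (feasible J).exists_max_image (fun S => toLex (virtualSurplus φ S v, τ S))
    ⟨∅, by simp [feasible]⟩

/-- The set served by Myerson's mechanism at the values `v`: the feasible set of maximum
virtual surplus; among several such sets, the one of highest priority `τ`. -/
def myersonAlloc (J : Matroid (Fin n)) (φ : Fin n → ℝ → EReal) (τ : Finset (Fin n) ↪ ℕ)
    (v : Fin n → ℝ) : Finset (Fin n) :=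
  Classical.choose (exists_myersonAlloc J φ τ v)

/-- The payments of Myerson's mechanism: an agent who is not served pays nothing, and an agent
who is served pays the infimum of the values at which it would still be served. -/
def myersonPayment (J : Matroid (Fin n)) (φ : Fin n → ℝ → EReal) (τ : Finset (Fin n) ↪ ℕ)
    (v : Fin n → ℝ) (i : Fin n) : ℝ :=
  if i ∈ myersonAlloc J φ τ v then
    sInf {z : ℝ | 0 ≤ z ∧ i ∈ myersonAlloc J φ τ (Function.update v i z)}
  else 0

/-- The expected revenue of Myerson's mechanism for independent values `v i ∼ μ i`. -/
def myersonRevenue (J : Matroid (Fin n)) (φ : Fin n → ℝ → EReal) (τ : Finset (Fin n) ↪ ℕ)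
    (μ : Fin n → Measure ℝ) : ℝ≥0∞ :=
  ∫⁻ v, ∑ i, ENNReal.ofReal (myersonPayment J φ τ v i) ∂(Measure.pi μ)

/-- The probability that Myerson's mechanism serves agent `i`. -/
def myersonProb (J : Matroid (Fin n)) (φ : Fin n → ℝ → EReal) (τ : Finset (Fin n) ↪ ℕ)
    (μ : Fin n → Measure ℝ) (i : Fin n) : ℝ :=
  (Measure.pi μ).real {v | i ∈ myersonAlloc J φ τ v}

/-! ### Sequential posted-price mechanisms -/

open Classical in
/-- The set served by the sequential posted-price mechanism with order `σ` (agent `σ k` comes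
in position `k`) and prices `p`, at the values `v`. -/
def spmServed (J : Matroid (Fin n)) (σ : Equiv.Perm (Fin n)) (p : Fin n → ℝ≥0∞)
    (v : Fin n → ℝ) : Finset (Fin n) :=
  (List.finRange n).foldl
    (fun A k =>
      if J.Indep ((insert (σ k) A : Finset (Fin n)) : Set (Fin n)) ∧
          p (σ k) ≤ ENNReal.ofReal (v (σ k)) then
        insert (σ k) A
      else A) ∅

/-- The expected revenue of the sequential posted-price mechanism with order `σ` and prices `p`. -/
def spmRevenue (J : Matroid (Fin n)) (σ : Equiv.Perm (Fin n)) (p : Fin n → ℝ≥0∞)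
    (μ : Fin n → Measure ℝ) : ℝ≥0∞ :=
  ∫⁻ v, ∑ i ∈ spmServed J σ p v, p i ∂(Measure.pi μ)

/-- The expected revenue of the sequential posted-price mechanism with order `σ` and random
prices, the price for agent `i` being drawn from `ν i` independently of everything else. -/
def randomSpmRevenue (J : Matroid (Fin n)) (σ : Equiv.Perm (Fin n)) (ν : Fin n → Measure ℝ≥0∞)
    (μ : Fin n → Measure ℝ) : ℝ≥0∞ :=
  ∫⁻ p, spmRevenue J σ p μ ∂(Measure.pi ν)

/-- The random price that is, with probability `x`, a proposal of `F⁻¹(1 - q₁)`, and, with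
probability `1 - x`, a proposal of `F⁻¹(1 - q₂)`; a proposal `p = F⁻¹(1 - q)` is actually offered
with probability `q / Pr[accept p]` (this is `1` if there are no point masses and `q > 0`), and
otherwise no offer is made, that is, the price is `∞`. -/
def priceLottery (μ : Measure ℝ) (x q₁ q₂ : ℝ) : Measure ℝ≥0∞ :=
  let p₁ := quantile μ (1 - q₁)
  let p₂ := quantile μ (1 - q₂)
  let w₁ := x * (q₁ / acceptProb μ p₁)
  let w₂ := (1 - x) * (q₂ / acceptProb μ p₂)
  ENNReal.ofReal w₁ • Measure.dirac p₁ + ENNReal.ofReal w₂ • Measure.dirac p₂ +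
    ENNReal.ofReal (1 - w₁ - w₂) • Measure.dirac ∞

end BSMD

end

/-! Myerson's mechanism enters only through feasibility and its payment rule. Fix the values of the
others and let `Q` be the probability that agent `i` is then served. A payment `t` is a lower bound
for the nonnegative values at which `i` is served, so `Q ≤ Pr[v_i ≥ t]` and `t` is at most the
quantile price of `Q`. Hence `i` pays at most `R_i(Q)` in expectation over its own value. As `Q` has
mean `q_i`, a line above `R_i` bounds the expected payment by the height of the line at `q_i`
(`lintegral_paymentBound_le_affine`).

That height is what the posted prices raise from `i` when every offer can be made. In the regular
case the line supports `R_i` itself, with the virtual value as slope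
(`exists_supporting_line_of_isRegular`). In general it supports the ironed curve, and it touches
`R_i` on both sides of `q_i`, because otherwise it could be tilted and lowered (`exists_contact`);
mixing the two contact prices attains the height.

What remains is combinatorial (`sum_le_two_mul_greedy`). Agents are active independently with
probabilities `q_i`, which satisfy the matroid rank constraints as an average of independent sets
(`sum_myersonProb_le_card`), and are taken greedily in decreasing order of reward `c_i`. For a
threshold `t` let `S` be the selected agents with `c_i > t`. An agent above `t` is either unblocked
at its turn or in the span of `S`. The first kind contributes `E|S|` to the sum of the `q_i`, since
being unblocked is independent of being active; the second contributes at most `E|S|` by the rank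
constraint. Integrating over `t` gives the factor 2. -/

noncomputable section

namespace BSMD

/-! ### Integrals over product measures -/

section ProductIntegrals

variable {ι X : Type*} [Fintype ι] [DecidableEq ι] [MeasurableSpace X]
  (m : ι → Measure X) [∀ i, IsProbabilityMeasure (m i)]

theorem lintegral_pi_update (i : ι) {F : (ι → X) → ℝ≥0∞} (hF : Measurable F) :
    ∫⁻ v, F v ∂Measure.pi m = ∫⁻ v, ∫⁻ z, F (Function.update v i z) ∂m i ∂Measure.pi m := by
  have h := lmarginal_singleton (μ := m) F i
  rw [show (fun v => ∫⁻ z, F (Function.update v i z) ∂m i) = ∫⋯∫⁻_{i}, F ∂m from h.symm]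
  refine lintegral_eq_of_lmarginal_eq {i} hF (hF.lmarginal m) ?_
  rw [lmarginal_singleton (μ := m) (∫⋯∫⁻_{i}, F ∂m), h]
  simp

/-- Independence of coordinate `i` from a functional that ignores it. It is applied with `G` the
indicator that agent `i` is unblocked at its turn and `h` its reward when active. -/
theorem lintegral_pi_mul_eval (i : ι) {G : (ι → X) → ℝ≥0∞} (hG : Measurable G)
    (hGi : ∀ v z, G (Function.update v i z) = G v) {h : X → ℝ≥0∞} (hh : Measurable h) :
    ∫⁻ v, G v * h (v i) ∂Measure.pi m = (∫⁻ v, G v ∂Measure.pi m) * ∫⁻ x, h x ∂m i := by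
  rw [lintegral_pi_update m i (by fun_prop)]
  simp only [hGi, Function.update_self]
  simp_rw [lintegral_const_mul _ hh]
  rw [lintegral_mul_const _ hG]

end ProductIntegrals

/-- Summation by layers: it suffices to compare the sums over all superlevel sets of the
weights. -/
theorem sum_mul_le_sum_mul_of_superlevel {ι : Type*} [Fintype ι] (c a b : ι → ℝ≥0∞)
    (h : ∀ t : ℝ≥0∞, ∑ i with t < c i, a i ≤ ∑ i with t < c i, b i) :
    ∑ i, c i * a i ≤ ∑ i, c i * b i := by
  -- Layer cake: a weight is the length of the set of thresholds below it, including the weight `∞`.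
  have hvol : ∀ c : ℝ≥0∞, ∫⁻ t : ℝ in Ioi 0, (if ENNReal.ofReal t < c then 1 else 0) = c := by
    intro c
    have : ∀ t : ℝ, (if ENNReal.ofReal t < c then (1 : ℝ≥0∞) else 0) =
        {t : ℝ | ENNReal.ofReal t < c}.indicator 1 t := fun t => by simp [Set.indicator]
    simp_rw [this]
    have hm : MeasurableSet {t : ℝ | ENNReal.ofReal t < c} :=
      measurableSet_lt ENNReal.measurable_ofReal measurable_const
    rw [lintegral_indicator_one hm, Measure.restrict_apply hm]
    rcases eq_or_ne c ∞ with rfl | hc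
    · simp
    · have : {t : ℝ | ENNReal.ofReal t < c} ∩ Ioi 0 = Ioo 0 c.toReal := by
        ext t
        simp only [mem_inter_iff, mem_ofPred_eq, mem_Ioi, mem_Ioo]
        constructor
        · rintro ⟨h1, h2⟩
          exact ⟨h2, (ENNReal.ofReal_lt_iff_lt_toReal h2.le hc).1 h1⟩
        · rintro ⟨h1, h2⟩
          exact ⟨(ENNReal.ofReal_lt_iff_lt_toReal h1.le hc).2 h2, h1⟩
      rw [this, Real.volume_Ioo, sub_zero, ENNReal.ofReal_toReal hc]
  have key : ∀ a : ι → ℝ≥0∞, ∑ i, c i * a i =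
      ∫⁻ t : ℝ in Ioi 0, ∑ i with ENNReal.ofReal t < c i, a i := by
    intro a
    have hm : ∀ i, Measurable fun t : ℝ => (if ENNReal.ofReal t < c i then (1 : ℝ≥0∞) else 0) :=
      fun i => Measurable.ite (measurableSet_lt ENNReal.measurable_ofReal measurable_const)
        measurable_const measurable_const
    have : ∀ t : ℝ, ∑ i with ENNReal.ofReal t < c i, a i =
        ∑ i, (if ENNReal.ofReal t < c i then 1 else 0) * a i := fun t => by
      rw [Finset.sum_filter]
      exact Finset.sum_congr rfl fun i _ => by split_ifs <;> simp
    simp_rw [this]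
    rw [lintegral_finsetSum _ fun i _ => (hm i).mul_const _]
    exact Finset.sum_congr rfl fun i _ => by rw [lintegral_mul_const _ (hm i), hvol]
  rw [key a, key b]
  exact lintegral_mono fun t => h _

/-! ### Greedy selection in a matroid -/

section Greedy

variable {n : ℕ}

open Classical in
/-- The set selected from `T` by the greedy algorithm after the first `k` elements in the
order `σ` have been considered. -/
def greedy (J : Matroid (Fin n)) (σ : Equiv.Perm (Fin n)) (T : Set (Fin n)) :
    ℕ → Finset (Fin n)
  | 0 => ∅
  | k + 1 =>
    if h : k < n then
      if J.Indep ((insert (σ ⟨k, h⟩) (greedy J σ T k) : Finset (Fin n)) : Set (Fin n)) ∧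
          σ ⟨k, h⟩ ∈ T then
        insert (σ ⟨k, h⟩) (greedy J σ T k)
      else greedy J σ T k
    else greedy J σ T k

theorem foldl_finRange_eq {α : Type*} (n : ℕ) (f : α → Fin n → α) (g : ℕ → α)
    (hg : ∀ k (h : k < n), g (k + 1) = f (g k) ⟨k, h⟩) :
    (List.finRange n).foldl f (g 0) = g n := by
  induction n with
  | zero => simp
  | succ n ih =>
    have := ih (fun a i => f a i.castSucc) fun k h => hg k (h.trans n.lt_succ_self)
    rw [List.finRange_succ_last, List.foldl_append, List.foldl_map, this, hg n n.lt_succ_self]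
    rfl

theorem spmServed_eq_greedy (J : Matroid (Fin n)) (σ : Equiv.Perm (Fin n)) (p : Fin n → ℝ≥0∞)
    (v : Fin n → ℝ) :
    spmServed J σ p v = greedy J σ {i | p i ≤ ENNReal.ofReal (v i)} n := by
  unfold spmServed
  refine foldl_finRange_eq n _ (greedy J σ {i | p i ≤ ENNReal.ofReal (v i)}) fun k h => ?_
  rw [greedy]
  simp [h]

variable (J : Matroid (Fin n)) (σ : Equiv.Perm (Fin n))

theorem greedy_indep (T : Set (Fin n)) (k : ℕ) : J.Indep (greedy J σ T k : Set (Fin n)) := by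
  induction k with
  | zero => simp [greedy]
  | succ k ih =>
    rw [greedy]
    split_ifs with h1 h2
    · exact h2.1
    · exact ih
    · exact ih

/-- An agent can enter only at its own turn, so the state just before that turn decides its
membership at every later time. -/
theorem mem_greedy (T : Set (Fin n)) (k : ℕ) (j : Fin n) :
    σ j ∈ greedy J σ T k ↔ (j : ℕ) < k ∧ σ j ∈ T ∧
      J.Indep (insert (σ j) (greedy J σ T j : Set (Fin n))) := by
  induction k with
  | zero => simp [greedy]
  | succ k ih =>
    rw [greedy]
    by_cases hjk : (j : ℕ) = k
    · subst hjk
      simp only [j.isLt, dite_true, Fin.eta]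
      have : σ j ∉ greedy J σ T j := by simp [ih]
      split_ifs with h2
      · simp only [Finset.mem_insert_self, true_iff]
        exact ⟨Nat.lt_succ_self _, h2.2, by simpa using h2.1⟩
      · simp only [this, false_iff]
        rintro ⟨-, h3, h4⟩
        exact h2 ⟨by simpa using h4, h3⟩
    · have hlt : (j : ℕ) < k + 1 ↔ (j : ℕ) < k := by omega
      rw [hlt, ← ih]
      split_ifs with h1 h2
      · rw [Finset.mem_insert, or_iff_right]
        intro h
        exact hjk (by rw [σ.injective h])
      · rfl
      · rfl

/-- The first `k` steps inspect only the first `k` agents. This is the source of the independence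
between being active and being unblocked. -/
theorem greedy_congr {T T' : Set (Fin n)} (k : ℕ)
    (h : ∀ j : Fin n, (j : ℕ) < k → (σ j ∈ T ↔ σ j ∈ T')) :
    greedy J σ T k = greedy J σ T' k := by
  induction k with
  | zero => rfl
  | succ k ih =>
    have ih := ih fun j hj => h j (by omega)
    by_cases hk : k < n
    · have hT := h ⟨k, hk⟩ (Nat.lt_succ_self k)
      rw [greedy, greedy, ih]
      rw [dif_pos hk, dif_pos hk]
      split_ifs <;> tauto
    · rw [greedy, greedy, ih]
      simp only [hk, dite_false]

end Greedy

/-! ### Sequential selection from independent activations -/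

section Selection

variable {n : ℕ} {X : Type*} [MeasurableSpace X]

theorem measurable_comp_activeSet {A : Set X} (hA : MeasurableSet A)
    (g : Set (Fin n) → ℝ≥0∞) : Measurable fun ω : Fin n → X => g {i | ω i ∈ A} := by
  let _ : MeasurableSpace (Set (Fin n)) := ⊤
  have hT : Measurable fun ω : Fin n → X => {i | ω i ∈ A} := by
    refine measurable_to_countable' fun S => ?_
    have : (fun ω : Fin n → X => {i | ω i ∈ A}) ⁻¹' {S} = ⋂ i, {ω | ω i ∈ A ↔ i ∈ S} := by
      ext ω
      simp [Set.ext_iff]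
    rw [this]
    refine MeasurableSet.iInter fun i => ?_
    by_cases hi : i ∈ S
    · simpa only [hi, iff_true] using! hA.preimage (measurable_pi_apply i)
    · simpa only [hi, iff_false] using! (hA.preimage (measurable_pi_apply i)).compl
  exact measurable_from_top.comp hT

open Classical in
/-- If the activation probabilities satisfy the rank constraints of the matroid, and the expected
rewards given activation are non-increasing along the order, then greedy selection from the active
agents collects at least half of the total expected reward. -/
theorem sum_le_two_mul_greedy (J : Matroid (Fin n)) (σ : Equiv.Perm (Fin n))
    (m : Fin n → Measure X) [∀ i, IsProbabilityMeasure (m i)] {A : Set X} (hA : MeasurableSet A)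
    {w : X → ℝ≥0∞} (hw : Measurable w) (c : Fin n → ℝ≥0∞) (hc : Antitone fun k => c (σ k))
    (hcw : ∀ i, ∫⁻ x in A, w x ∂m i = c i * m i A)
    (hq : ∀ S : Finset (Fin n), J.Indep (S : Set (Fin n)) →
      ∑ i with i ∈ S ∨ ¬ J.Indep (insert i (S : Set (Fin n))), m i A ≤ S.card) :
    ∑ i, c i * m i A ≤
      2 * ∫⁻ ω, ∑ i ∈ greedy J σ {i | ω i ∈ A} n, w (ω i) ∂Measure.pi m := by
  -- `u T i` indicates that `i` is unblocked at its turn, whether or not it is active itself.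
  let u : Set (Fin n) → Fin n → ℝ≥0∞ := fun T i =>
    if J.Indep (insert i (greedy J σ T (σ.symm i) : Set (Fin n))) then 1 else 0
  let T : (Fin n → X) → Set (Fin n) := fun ω => {i | ω i ∈ A}
  let U : Fin n → ℝ≥0∞ := fun i => ∫⁻ ω, u (T ω) i ∂Measure.pi m
  have hum : ∀ i, Measurable fun ω => u (T ω) i := fun i =>
    measurable_comp_activeSet hA fun T => u T i
  have hmem : ∀ T i, i ∈ greedy J σ T n ↔ i ∈ T ∧
      J.Indep (insert i (greedy J σ T (σ.symm i) : Set (Fin n))) := by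
    intro T i
    have := mem_greedy J σ T n (σ.symm i)
    simpa using this
  have hserve : ∀ (h : X → ℝ≥0∞), Measurable h → ∀ i,
      ∫⁻ ω, (if i ∈ greedy J σ (T ω) n then h (ω i) else 0) ∂Measure.pi m =
        U i * ∫⁻ x in A, h x ∂m i := by
    intro h hh i
    rw [← lintegral_indicator hA, ← lintegral_pi_mul_eval m i (hum i) ?_ (hh.indicator hA)]
    · refine lintegral_congr fun ω => ?_
      simp only [hmem, u, Set.indicator, T, mem_ofPred_eq]
      by_cases h1 : ω i ∈ A <;> simp [h1]
    · intro v z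
      simp only [u]
      rw [greedy_congr J σ (T := T (Function.update v i z)) (T' := T v) _ fun j hj => ?_]
      have : σ j ≠ i := by
        rintro rfl
        simp at hj
      simp [T, this]
  have hrev : ∫⁻ ω, ∑ i ∈ greedy J σ {i | ω i ∈ A} n, w (ω i) ∂Measure.pi m =
      ∑ i, c i * (U i * m i A) := by
    have : ∀ ω : Fin n → X, ∑ i ∈ greedy J σ {i | ω i ∈ A} n, w (ω i) =
        ∑ i, if i ∈ greedy J σ (T ω) n then w (ω i) else 0 := fun ω => by
      rw [← Finset.sum_filter]
      simp [T]
    simp_rw [this]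
    rw [lintegral_finsetSum]
    · exact Finset.sum_congr rfl fun i _ => by rw [hserve w hw, hcw]; ring
    · intro i _
      have : (fun ω => if i ∈ greedy J σ (T ω) n then w (ω i) else 0) =
          fun ω => (if i ∈ greedy J σ (T ω) n then 1 else 0) * w (ω i) := by
        ext ω
        split_ifs <;> simp
      rw [this]
      exact (measurable_comp_activeSet hA
        (fun T => if i ∈ greedy J σ T n then 1 else 0)).mul (by fun_prop)
  rw [hrev, Finset.mul_sum]
  rw [Finset.sum_congr rfl fun i _ => mul_left_comm 2 (c i) (U i * m i A)]
  refine sum_mul_le_sum_mul_of_superlevel c _ _ fun t => ?_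
  let S : Set (Fin n) → Finset (Fin n) := fun T => (greedy J σ T n).filter fun i => t < c i
  have hSI : ∀ T, J.Indep (S T : Set (Fin n)) := fun T =>
    (greedy_indep J σ T n).subset (by exact_mod_cast Finset.filter_subset _ _)
  -- `b T i` indicates that `i` lies in the span of `S T`.
  let b : Set (Fin n) → Fin n → ℝ≥0∞ := fun T i =>
    if i ∈ S T ∨ ¬ J.Indep (insert i (S T : Set (Fin n))) then 1 else 0
  have hbm : ∀ i, Measurable fun ω => b (T ω) i := fun i =>
    measurable_comp_activeSet hA fun T => b T i
  -- Everything selected before `i` has reward at least `c i > t` and so belongs to `S T`. If `S T`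
  -- does not span `i`, the smaller set present at its turn cannot block it.
  have hub : ∀ T i, t < c i → 1 ≤ u T i + b T i := by
    intro T i hi
    by_cases h1 : i ∈ S T ∨ ¬ J.Indep (insert i (S T : Set (Fin n)))
    · simp [b, h1]
    · push Not at h1
      have : J.Indep (insert i (greedy J σ T (σ.symm i) : Set (Fin n))) := by
        refine h1.2.subset (insert_subset_insert fun j hj => ?_)
        obtain ⟨k, rfl⟩ := σ.surjective j
        have hj := (mem_greedy J σ T _ k).1 hj
        have hk : k ≤ σ.symm i := Fin.le_def.2 hj.1.le
        have hck : c i ≤ c (σ k) := by simpa using hc hk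
        exact Finset.mem_coe.2 (Finset.mem_filter.2
          ⟨(mem_greedy J σ T n k).2 ⟨k.isLt, hj.2⟩, hi.trans_le hck⟩)
      simp [u, this]
  have hcard : ∫⁻ ω, ((S (T ω)).card : ℝ≥0∞) ∂Measure.pi m = ∑ i with t < c i, U i * m i A := by
    have : ∀ ω, ((S (T ω)).card : ℝ≥0∞) =
        ∑ i with t < c i, if i ∈ greedy J σ (T ω) n then 1 else 0 := fun ω => by
      rw [← Finset.sum_filter, Finset.filter_filter]
      simp only [S, Finset.sum_const, nsmul_eq_mul, mul_one]
      congr 2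
      ext i
      simp [and_comm]
    simp_rw [this]
    rw [lintegral_finsetSum]
    · refine Finset.sum_congr rfl fun i _ => ?_
      have := hserve (fun _ => 1) measurable_const i
      simpa using this
    · intro i _
      exact measurable_comp_activeSet hA fun T => if i ∈ greedy J σ T n then 1 else 0
  calc ∑ i with t < c i, m i A
      ≤ ∑ i with t < c i, (U i * m i A + m i A * ∫⁻ ω, b (T ω) i ∂Measure.pi m) := by
        refine Finset.sum_le_sum fun i hi => ?_
        have : 1 ≤ U i + ∫⁻ ω, b (T ω) i ∂Measure.pi m := by
          rw [← lintegral_add_left (hum i)]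
          calc (1 : ℝ≥0∞) = ∫⁻ ω, 1 ∂Measure.pi m := by simp
            _ ≤ _ := lintegral_mono fun ω => hub _ _ (Finset.mem_filter.1 hi).2
        calc m i A = 1 * m i A := (one_mul _).symm
          _ ≤ (U i + ∫⁻ ω, b (T ω) i ∂Measure.pi m) * m i A := by gcongr
          _ = _ := by ring
    _ = ∑ i with t < c i, U i * m i A +
          ∫⁻ ω, ∑ i with t < c i, m i A * b (T ω) i ∂Measure.pi m := by
        rw [Finset.sum_add_distrib, lintegral_finsetSum _ fun i _ => (hbm i).const_mul _]
        congr 1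
        exact Finset.sum_congr rfl fun i _ => by rw [lintegral_const_mul _ (hbm i)]
    _ ≤ ∑ i with t < c i, U i * m i A + ∫⁻ ω, ((S (T ω)).card : ℝ≥0∞) ∂Measure.pi m := by
        gcongr with ω
        refine le_trans ?_ (hq _ (hSI (T ω)))
        calc ∑ i with t < c i, m i A * b (T ω) i ≤ ∑ i, m i A * b (T ω) i :=
              Finset.sum_le_sum_of_subset (Finset.filter_subset _ _)
          _ = _ := by
            rw [Finset.sum_filter]
            refine Finset.sum_congr rfl fun i _ => ?_
            simp only [b]
            split_ifs <;> simp
    _ = ∑ i with t < c i, 2 * (U i * m i A) := by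
        rw [hcard, ← Finset.mul_sum, two_mul]

end Selection

/-! ### Posted prices as greedy selection -/

section PostedPrices

variable {n : ℕ}

/-- The pairs of a price and a value at which the price is accepted. -/
def acceptSet : Set (ℝ≥0∞ × ℝ) := {x | x.1 ≤ ENNReal.ofReal x.2}

theorem measurableSet_acceptSet : MeasurableSet acceptSet :=
  measurableSet_le measurable_fst (ENNReal.measurable_ofReal.comp measurable_snd)

/-- Pairing each agent's price with its value makes the agents independent coordinates, active when
the pair lies in `acceptSet`. -/
theorem randomSpmRevenue_eq (J : Matroid (Fin n)) (σ : Equiv.Perm (Fin n))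
    (ν : Fin n → Measure ℝ≥0∞) (μ : Fin n → Measure ℝ) [∀ i, IsProbabilityMeasure (ν i)]
    [∀ i, IsProbabilityMeasure (μ i)] :
    randomSpmRevenue J σ ν μ =
      ∫⁻ ω, ∑ i ∈ greedy J σ {i | ω i ∈ acceptSet} n, (ω i).1
        ∂Measure.pi fun i => (ν i).prod (μ i) := by
  let e := MeasurableEquiv.arrowProdEquivProdArrow ℝ≥0∞ ℝ (Fin n)
  have he := measurePreserving_arrowProdEquivProdArrow ℝ≥0∞ ℝ (Fin n) ν μ
  let F : (Fin n → ℝ≥0∞ × ℝ) → ℝ≥0∞ := fun ω =>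
    ∑ i ∈ greedy J σ {i | ω i ∈ acceptSet} n, (ω i).1
  have hF : Measurable F := by
    classical
    have : F = fun ω => ∑ i,
        (if i ∈ greedy J σ {i | ω i ∈ acceptSet} n then 1 else 0) * (ω i).1 := by
      ext ω
      simp [F]
    rw [this]
    exact Finset.measurable_sum _ fun i _ => (measurable_comp_activeSet measurableSet_acceptSet
      fun T => if i ∈ greedy J σ T n then 1 else 0).mul (by fun_prop)
  have hFe : ∀ p v, F (e.symm (p, v)) = ∑ i ∈ spmServed J σ p v, p i := by
    intro p v
    rw [spmServed_eq_greedy]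
    rfl
  calc randomSpmRevenue J σ ν μ
      = ∫⁻ p, ∫⁻ v, F (e.symm (p, v)) ∂Measure.pi μ ∂Measure.pi ν := by
        simp only [randomSpmRevenue, spmRevenue, hFe]
    _ = ∫⁻ x, F (e.symm x) ∂(Measure.pi ν).prod (Measure.pi μ) :=
        (lintegral_prod _ (hF.comp e.symm.measurable).aemeasurable).symm
    _ = ∫⁻ ω, F ω ∂Measure.pi fun i => (ν i).prod (μ i) := by
        rw [← he.lintegral_comp_emb e.measurableEmbedding]
        exact lintegral_congr fun ω => by simp [e]

theorem randomSpmRevenue_dirac (J : Matroid (Fin n)) (σ : Equiv.Perm (Fin n))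
    (p : Fin n → ℝ≥0∞) (μ : Fin n → Measure ℝ) :
    randomSpmRevenue J σ (fun i => Measure.dirac (p i)) μ = spmRevenue J σ p μ := by
  have h : Measure.pi (fun i => Measure.dirac (p i)) = Measure.dirac p := by
    refine Measure.pi_eq fun s hs => ?_
    rw [Measure.dirac_apply' _ (MeasurableSet.univ_pi hs)]
    simp_rw [Measure.dirac_apply' _ (hs _)]
    by_cases hp : p ∈ Set.pi univ s
    · rw [Set.indicator_of_mem hp]
      refine (Finset.prod_eq_one fun i _ => ?_).symm
      rw [Set.indicator_of_mem (hp i (mem_univ i))]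
      rfl
    · rw [Set.indicator_of_notMem hp]
      simp only [Set.mem_pi, mem_univ, true_imp_iff, not_forall] at hp
      obtain ⟨i, hi⟩ := hp
      exact (Finset.prod_eq_zero (Finset.mem_univ i) (Set.indicator_of_notMem hi _)).symm
  rw [randomSpmRevenue, h, lintegral_dirac]

end PostedPrices

/-! ### The allocation of Myerson's mechanism -/

section Allocation

variable {n : ℕ} (J : Matroid (Fin n)) (φ : Fin n → ℝ → EReal) (τ : Finset (Fin n) ↪ ℕ)

theorem myersonAlloc_mem (v : Fin n → ℝ) : myersonAlloc J φ τ v ∈ feasible J :=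
  (Classical.choose_spec (exists_myersonAlloc J φ τ v)).1

theorem myersonAlloc_indep (v : Fin n → ℝ) : J.Indep (myersonAlloc J φ τ v : Set (Fin n)) := by
  classical
  exact (Finset.mem_filter.1 (myersonAlloc_mem J φ τ v)).2

/-- Injectivity of `τ` makes the lexicographic maximizer unique. The allocation is thus determined
by finitely many comparisons, which gives its measurability. -/
theorem myersonAlloc_eq_iff (v : Fin n → ℝ) (S : Finset (Fin n)) :
    myersonAlloc J φ τ v = S ↔ S ∈ feasible J ∧ ∀ T ∈ feasible J,
      toLex (virtualSurplus φ T v, τ T) ≤ toLex (virtualSurplus φ S v, τ S) := by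
  have h := Classical.choose_spec (exists_myersonAlloc J φ τ v)
  constructor
  · rintro rfl
    exact h
  · rintro ⟨hS, hmax⟩
    have := le_antisymm (hmax _ h.1) (h.2 S hS)
    exact τ.injective (congrArg Prod.snd (toLex.injective this))

variable {φ}

theorem measurableSet_mem_myersonAlloc (hφ : ∀ i, Measurable (φ i)) (i : Fin n) :
    MeasurableSet {v | i ∈ myersonAlloc J φ τ v} := by
  have hs : ∀ S, Measurable fun v => virtualSurplus φ S v := fun S =>
    Finset.measurable_sum _ fun i _ => (hφ i).comp (measurable_pi_apply i)
  have hle : ∀ S T : Finset (Fin n), MeasurableSet {v : Fin n → ℝ |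
      toLex (virtualSurplus φ T v, τ T) ≤ toLex (virtualSurplus φ S v, τ S)} := by
    intro S T
    simp only [Prod.Lex.toLex_le_toLex]
    exact (measurableSet_lt (hs T) (hs S)).union
      ((measurableSet_eq_fun (hs T) (hs S)).inter (MeasurableSet.const _))
  have : {v | i ∈ myersonAlloc J φ τ v} = ⋃ S ∈ {S : Finset (Fin n) | i ∈ S},
      {v | myersonAlloc J φ τ v = S} := by
    ext v
    simp
  rw [this]
  refine MeasurableSet.biUnion (to_countable _) fun S _ => ?_
  simp only [myersonAlloc_eq_iff]
  refine (MeasurableSet.const _).inter ?_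
  have : {v | ∀ T ∈ feasible J,
      toLex (virtualSurplus φ T v, τ T) ≤ toLex (virtualSurplus φ S v, τ S)} =
      ⋂ T ∈ (feasible J : Set (Finset (Fin n))), {v : Fin n → ℝ |
        toLex (virtualSurplus φ T v, τ T) ≤ toLex (virtualSurplus φ S v, τ S)} := by
    ext v
    simp
  change MeasurableSet {v | ∀ T ∈ feasible J,
      toLex (virtualSurplus φ T v, τ T) ≤ toLex (virtualSurplus φ S v, τ S)}
  rw [this]
  exact MeasurableSet.biInter (to_countable _) fun T _ => hle S T

open Classical in
/-- The service probabilities satisfy the rank constraints of the matroid. -/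
theorem sum_myersonProb_le_card (hφ : ∀ i, Measurable (φ i)) (μ : Fin n → Measure ℝ)
    [∀ i, IsProbabilityMeasure (μ i)] (S : Finset (Fin n)) (hS : J.Indep (S : Set (Fin n))) :
    ∑ i with i ∈ S ∨ ¬ J.Indep (insert i (S : Set (Fin n))),
      ENNReal.ofReal (myersonProb J φ τ μ i) ≤ S.card := by
  set U : Finset (Fin n) :=
    Finset.univ.filter fun i => i ∈ S ∨ ¬ J.Indep (insert i (S : Set (Fin n)))
  -- `U` is the span of `S`: a larger independent subset of `U` would augment `S` by an element that
  -- `U` excludes.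
  have hU : ∀ v, ((myersonAlloc J φ τ v) ∩ U).card ≤ S.card := by
    intro v
    by_contra! hlt
    obtain ⟨e, he, heS, hI⟩ := hS.augment_finset
      (J := myersonAlloc J φ τ v ∩ U)
      ((myersonAlloc_indep J φ τ v).subset (by
        exact_mod_cast Finset.inter_subset_left)) hlt
    have := (Finset.mem_filter.1 (Finset.mem_inter.1 he).2).2
    tauto
  calc ∑ i ∈ U, ENNReal.ofReal (myersonProb J φ τ μ i)
      = ∑ i ∈ U, ∫⁻ v, {v | i ∈ myersonAlloc J φ τ v}.indicator 1 v ∂Measure.pi μ := by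
        refine Finset.sum_congr rfl fun i _ => ?_
        rw [lintegral_indicator_one (measurableSet_mem_myersonAlloc J τ hφ i), myersonProb,
          ofReal_measureReal]
    _ = ∫⁻ v, ∑ i ∈ U, {v | i ∈ myersonAlloc J φ τ v}.indicator 1 v ∂Measure.pi μ :=
        (lintegral_finsetSum _ fun i _ =>
          measurable_one.indicator (measurableSet_mem_myersonAlloc J τ hφ i)).symm
    _ ≤ ∫⁻ _, (S.card : ℝ≥0∞) ∂Measure.pi μ := by
        refine lintegral_mono fun v => ?_
        refine le_trans (le_of_eq ?_) (Nat.cast_le.2 (hU v))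
        simp [Set.indicator, Finset.inter_comm]
    _ = S.card := by simp

end Allocation

/-! ### Quantiles -/

section Quantile

variable (μ : Measure ℝ)

theorem ofReal_le_quantile {v t : ℝ} (h : cdf μ v ≤ t) : ENNReal.ofReal v ≤ quantile μ t :=
  le_iSup₂_of_le v h le_rfl

theorem quantile_le_ofReal {v t : ℝ} (h : t < cdf μ v) : quantile μ t ≤ ENNReal.ofReal v := by
  refine iSup₂_le fun w hw => ENNReal.ofReal_le_ofReal ?_
  by_contra! hvw
  exact absurd ((monotone_cdf μ hvw.le).trans hw) (not_le.2 h)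

theorem cdf_le_of_lt_quantile {v t : ℝ} (h : ENNReal.ofReal v < quantile μ t) :
    cdf μ v ≤ t := by
  by_contra! hlt
  exact absurd (quantile_le_ofReal μ hlt) (not_le.2 h)

theorem lt_cdf_of_quantile_lt {v t : ℝ} (h : quantile μ t < ENNReal.ofReal v) :
    t < cdf μ v := by
  by_contra! hle
  exact absurd (ofReal_le_quantile μ hle) (not_le.2 h)

theorem monotone_quantile : Monotone (quantile μ) := fun _ _ h =>
  iSup₂_le fun _ hv => ofReal_le_quantile μ (hv.trans h)

theorem quantile_ne_top {t : ℝ} (ht : t < 1) : quantile μ t ≠ ∞ := by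
  obtain ⟨v, hv⟩ := ((tendsto_cdf_atTop μ).eventually_const_lt ht).exists
  exact ne_top_of_le_ne_top ENNReal.ofReal_ne_top (quantile_le_ofReal μ hv)

theorem quantile_one : quantile μ 1 = ∞ := by
  refine ENNReal.eq_top_of_forall_nnreal_le fun r => ?_
  have := ofReal_le_quantile μ (cdf_le_one μ (r : ℝ))
  simpa using this

theorem revenueCurve_zero : revenueCurve μ 0 = 0 := by simp [revenueCurve]

theorem revenueCurve_nonneg {q : ℝ} (hq : 0 ≤ q) : 0 ≤ revenueCurve μ q :=
  mul_nonneg hq ENNReal.toReal_nonneg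

theorem ofReal_revenueCurve {q : ℝ} (hq : 0 ≤ q) :
    ENNReal.ofReal (revenueCurve μ q) = quantile μ (1 - q) * ENNReal.ofReal q := by
  rcases hq.eq_or_lt with rfl | hq
  · simp [revenueCurve]
  · rw [revenueCurve, ENNReal.ofReal_mul hq.le,
      ENNReal.ofReal_toReal (quantile_ne_top μ (by linarith)), mul_comm]

theorem acceptProb_top : acceptProb μ ∞ = 0 := by
  simp [acceptProb]

theorem acceptProb_eq {p : ℝ≥0∞} (h0 : p ≠ 0) (h : p ≠ ∞) :
    acceptProb μ p = μ.real (Ici p.toReal) := by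
  unfold acceptProb
  congr 1
  ext v
  have hp : 0 < p.toReal := ENNReal.toReal_pos h0 h
  simp only [mem_ofPred_eq, mem_Ici]
  constructor
  · intro hv
    have hv0 : 0 ≤ v := by
      by_contra! hneg
      rw [ENNReal.ofReal_of_nonpos hneg.le] at hv
      exact h0 (le_antisymm hv bot_le)
    exact (ENNReal.le_ofReal_iff_toReal_le h hv0).1 hv
  · intro hv
    exact (ENNReal.le_ofReal_iff_toReal_le h (hp.le.trans hv)).2 hv

variable [IsProbabilityMeasure μ]

theorem cdf_add_measureReal_Ioi (v : ℝ) : cdf μ v + μ.real (Ioi v) = 1 := by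
  rw [cdf_eq_real, ← compl_Iic, measureReal_compl measurableSet_Iic]
  simp

theorem measureReal_Ici_ge {p q : ℝ} (h : ∀ v < p, q ≤ μ.real (Ioi v)) :
    q ≤ μ.real (Ici p) := by
  have hlim : Tendsto (cdf μ) (𝓝[<] p) (𝓝 (μ.real (Iio p))) := by
    have h1 := (monotone_cdf μ).tendsto_leftLim p
    have h2 : μ (Iio p) = ENNReal.ofReal (Function.leftLim (cdf μ) p) := by
      have := (cdf μ).measure_Iio (tendsto_cdf_atBot μ) p
      rwa [measure_cdf, sub_zero] at this
    have h3 : μ.real (Iio p) = Function.leftLim (cdf μ) p := by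
      rw [measureReal_def, h2, ENNReal.toReal_ofReal]
      exact (cdf_nonneg μ (p - 1)).trans ((monotone_cdf μ).le_leftLim (by linarith))
    rwa [h3]
  have hle : μ.real (Iio p) ≤ 1 - q := by
    refine le_of_tendsto hlim ?_
    filter_upwards [self_mem_nhdsWithin] with v hv
    have := h v hv
    have := cdf_add_measureReal_Ioi μ v
    linarith
  rw [← compl_Iio, measureReal_compl measurableSet_Iio]
  simp only [probReal_univ]
  linarith

/-- Only an inequality, since an atom at the quantile price may push acceptance above `q`; the
lottery later thins out the offers by this excess. -/
theorem le_acceptProb_quantile {q : ℝ} (hq : 0 < q) (hq1 : q ≤ 1) :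
    q ≤ acceptProb μ (quantile μ (1 - q)) := by
  have htop := quantile_ne_top μ (show 1 - q < 1 by linarith)
  rcases eq_or_ne (quantile μ (1 - q)) 0 with h0 | h0
  · simp [acceptProb, h0, hq1]
  · rw [acceptProb_eq μ h0 htop]
    refine measureReal_Ici_ge μ fun v hv => ?_
    have hlt : ENNReal.ofReal v < quantile μ (1 - q) := by
      rw [← ENNReal.ofReal_toReal htop]
      exact (ENNReal.ofReal_lt_ofReal_iff (ENNReal.toReal_pos h0 htop)).2 hv
    have h1 := cdf_le_of_lt_quantile μ hlt
    have := cdf_add_measureReal_Ioi μ v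
    linarith

/-- A price that is accepted with probability at least `q` is at most the quantile of `q`. -/
theorem ofReal_le_quantile_of_le {t q : ℝ} (h : q ≤ μ.real (Ici t)) :
    ENNReal.ofReal t ≤ quantile μ (1 - q) := by
  -- If `t` is an atom, `cdf μ t` may exceed `1 - q`, so the quantile is compared with `v < t` and
  -- `v` tends to `t` from below.
  refine le_of_tendsto (ENNReal.continuous_ofReal.continuousAt.tendsto.mono_left
    (nhdsWithin_le_nhds (s := Iio t))) ?_
  filter_upwards [self_mem_nhdsWithin] with v hv
  refine ofReal_le_quantile μ ?_
  have h1 := cdf_add_measureReal_Ioi μ v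
  have h2 : μ.real (Ici t) ≤ μ.real (Ioi v) :=
    measureReal_mono fun x hx => mem_Ioi.2 (lt_of_lt_of_le hv hx)
  linarith

end Quantile

/-! ### An upper bound on the revenue of Myerson's mechanism -/

section Payment

variable {n : ℕ} (J : Matroid (Fin n)) {φ : Fin n → ℝ → EReal} (τ : Finset (Fin n) ↪ ℕ)
  (μ : Fin n → Measure ℝ) [∀ i, IsProbabilityMeasure (μ i)]

/-- The probability that agent `i` is served, given the values of the other agents. -/
def interimProb (φ : Fin n → ℝ → EReal) (i : Fin n) (v : Fin n → ℝ) : ℝ :=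
  (μ i).real {z | i ∈ myersonAlloc J φ τ (Function.update v i z)}

/-- A measurable upper bound on the payment of agent `i`: if served, it pays at most the quantile
of its interim service probability. -/
def paymentBound (φ : Fin n → ℝ → EReal) (i : Fin n) (v : Fin n → ℝ) : ℝ≥0∞ :=
  {v | i ∈ myersonAlloc J φ τ v}.indicator
    (fun v => quantile (μ i) (1 - interimProb J τ μ φ i v)) v

/-- Up to the null set of negative values, the values at which the agent is served lie above the
payment. The payment is therefore a price accepted with at least the interim service probability. -/
theorem ofReal_myersonPayment_le (hμ : ∀ i, μ i (Iio 0) = 0) (i : Fin n) (v : Fin n → ℝ) :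
    ENNReal.ofReal (myersonPayment J φ τ v i) ≤ paymentBound J τ μ φ i v := by
  by_cases hv : i ∈ myersonAlloc J φ τ v
  · rw [paymentBound, Set.indicator_of_mem (show v ∈ {v | i ∈ myersonAlloc J φ τ v} from hv),
      myersonPayment, if_pos hv]
    set A : Set ℝ := {z | i ∈ myersonAlloc J φ τ (Function.update v i z)} with hA
    set t : ℝ := sInf {z : ℝ | 0 ≤ z ∧ i ∈ myersonAlloc J φ τ (Function.update v i z)}
    refine ofReal_le_quantile_of_le (μ i) ?_
    have hae : μ i A ≤ μ i (Ici t) := by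
      calc μ i A ≤ μ i (Iio 0 ∪ Ici t) := by
            refine measure_mono fun z hz => ?_
            rcases lt_or_ge z 0 with h | h
            · exact Or.inl h
            · have hb : BddBelow {z : ℝ | 0 ≤ z ∧
                  i ∈ myersonAlloc J φ τ (Function.update v i z)} := ⟨0, fun y hy => hy.1⟩
              exact Or.inr (csInf_le hb ⟨h, hz⟩)
        _ ≤ μ i (Iio 0) + μ i (Ici t) := measure_union_le _ _
        _ = μ i (Ici t) := by rw [hμ, zero_add]
    exact ENNReal.toReal_mono (measure_ne_top _ _) hae
  · simp [myersonPayment, hv]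

theorem measurable_interimProb (hφ : ∀ i, Measurable (φ i)) (i : Fin n) :
    Measurable (interimProb J τ μ φ i) := by
  have hm : MeasurableSet {x : (Fin n → ℝ) × ℝ |
      i ∈ myersonAlloc J φ τ (Function.update x.1 i x.2)} := by
    refine (measurableSet_mem_myersonAlloc J τ hφ i).preimage (measurable_pi_iff.2 fun j => ?_)
    by_cases h : j = i
    · subst h
      simpa using measurable_snd
    · simpa [h] using! (measurable_pi_apply j).comp measurable_fst
  exact (measurable_measure_prodMk_left (ν := μ i) hm).ennreal_toReal

theorem interimProb_mem (i : Fin n) (v : Fin n → ℝ) : interimProb J τ μ φ i v ∈ Icc (0 : ℝ) 1 :=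
  ⟨measureReal_nonneg, measureReal_le_one⟩

theorem integrable_interimProb (hφ : ∀ i, Measurable (φ i)) (i : Fin n) :
    Integrable (interimProb J τ μ φ i) (Measure.pi μ) :=
  Integrable.of_bound (measurable_interimProb J τ μ hφ i).aestronglyMeasurable 1
    (ae_of_all _ fun v => by
      rw [Real.norm_of_nonneg (interimProb_mem J τ μ i v).1]
      exact (interimProb_mem J τ μ i v).2)

theorem measurable_paymentBound (hφ : ∀ i, Measurable (φ i)) (i : Fin n) :
    Measurable (paymentBound J τ μ φ i) :=
  ((monotone_quantile (μ i)).measurable.comp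
    (measurable_const.sub (measurable_interimProb J τ μ hφ i))).indicator
      (measurableSet_mem_myersonAlloc J τ hφ i)

/-- With the other values fixed, the bound is a constant on an event of probability `Q`, so it
integrates to `Q` times the quantile price. -/
theorem lintegral_paymentBound (hφ : ∀ i, Measurable (φ i)) (i : Fin n) :
    ∫⁻ v, paymentBound J τ μ φ i v ∂Measure.pi μ =
      ∫⁻ v, ENNReal.ofReal (revenueCurve (μ i) (interimProb J τ μ φ i v)) ∂Measure.pi μ := by
  rw [lintegral_pi_update μ i (measurable_paymentBound J τ μ hφ i)]
  refine lintegral_congr fun v => ?_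
  have hm : MeasurableSet {z | i ∈ myersonAlloc J φ τ (Function.update v i z)} :=
    (measurableSet_mem_myersonAlloc J τ hφ i).preimage (measurable_update v)
  rw [ofReal_revenueCurve _ (interimProb_mem J τ μ i v).1]
  nth_rw 2 [interimProb]
  rw [ofReal_measureReal, ← lintegral_indicator_const hm]
  refine lintegral_congr fun z => ?_
  have hQ : interimProb J τ μ φ i (Function.update v i z) = interimProb J τ μ φ i v := by
    simp [interimProb]
  simp only [paymentBound, Set.indicator, hQ]
  rfl

theorem integral_interimProb (hφ : ∀ i, Measurable (φ i)) (i : Fin n) :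
    ∫ v, interimProb J τ μ φ i v ∂Measure.pi μ = myersonProb J φ τ μ i := by
  have hm := measurableSet_mem_myersonAlloc J τ hφ i
  rw [integral_eq_lintegral_of_nonneg_ae (ae_of_all _ fun v => (interimProb_mem J τ μ i v).1)
    (measurable_interimProb J τ μ hφ i).aestronglyMeasurable, myersonProb, measureReal_def,
    ← lintegral_indicator_one hm, lintegral_pi_update μ i (measurable_one.indicator hm)]
  congr 1
  refine lintegral_congr fun v => ?_
  rw [interimProb, ofReal_measureReal]
  exact (lintegral_indicator_one (hm.preimage (measurable_update v))).symm

theorem myersonProb_mem (i : Fin n) : myersonProb J φ τ μ i ∈ Icc (0 : ℝ) 1 :=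
  ⟨measureReal_nonneg, measureReal_le_one⟩

/-- The expected payment of an agent is at most the value, at its service probability, of any
affine majorant of its revenue curve. -/
theorem lintegral_paymentBound_le_affine (hφ : ∀ i, Measurable (φ i)) (i : Fin n) (y s : ℝ)
    (h : ∀ r ∈ Icc (0 : ℝ) 1, revenueCurve (μ i) r ≤ y + s * (r - myersonProb J φ τ μ i)) :
    ∫⁻ v, paymentBound J τ μ φ i v ∂Measure.pi μ ≤ ENNReal.ofReal y := by
  rw [lintegral_paymentBound J τ μ hφ]
  have hQ := integrable_interimProb J τ μ hφ i
  have hQs : Integrable (fun v => s * (interimProb J τ μ φ i v - myersonProb J φ τ μ i))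
      (Measure.pi μ) := (hQ.sub (integrable_const _)).const_mul _
  -- The linear term vanishes because the interim probability has mean `myersonProb`; this is
  -- Jensen's inequality through a majorizing line.
  have hint : ∫ v, (y + s * (interimProb J τ μ φ i v - myersonProb J φ τ μ i)) ∂Measure.pi μ =
      y := by
    rw [integral_add (integrable_const _) hQs, integral_const_mul,
      integral_sub hQ (integrable_const _), integral_interimProb J τ μ hφ]
    simp
  calc _ ≤ ∫⁻ v, ENNReal.ofReal (y + s * (interimProb J τ μ φ i v - myersonProb J φ τ μ i))
        ∂Measure.pi μ :=
        lintegral_mono fun v => ENNReal.ofReal_le_ofReal (h _ (interimProb_mem J τ μ i v))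
    _ = ENNReal.ofReal y := by
        nth_rw 2 [← hint]
        exact (ofReal_integral_eq_lintegral_ofReal ((integrable_const y).add hQs)
          (ae_of_all _ fun v => (revenueCurve_nonneg _ (interimProb_mem J τ μ i v).1).trans
            (h _ (interimProb_mem J τ μ i v)))).symm

/-- An agent that is served with probability `0` or `1` pays at most its revenue curve. -/
theorem lintegral_paymentBound_le_of_extreme (hφ : ∀ i, Measurable (φ i)) (i : Fin n)
    (h : myersonProb J φ τ μ i = 0 ∨ myersonProb J φ τ μ i = 1) :
    ∫⁻ v, paymentBound J τ μ φ i v ∂Measure.pi μ ≤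
      ENNReal.ofReal (revenueCurve (μ i) (myersonProb J φ τ μ i)) := by
  have hQ := integrable_interimProb J τ μ hφ i
  -- A `[0, 1]`-valued variable whose mean is an endpoint is almost surely constant. This replaces
  -- the supporting line, which may have infinite slope there.
  have hae : ∀ᵐ v ∂Measure.pi μ, interimProb J τ μ φ i v = myersonProb J φ τ μ i := by
    have hint := integral_interimProb J τ μ hφ i
    rcases h with h | h
    · rw [h] at hint ⊢
      exact (integral_eq_zero_iff_of_nonneg (fun v => (interimProb_mem J τ μ i v).1) hQ).1 hint
    · rw [h] at hint ⊢
      have := (integral_eq_zero_iff_of_nonneg (μ := Measure.pi μ)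
        (f := fun v => 1 - interimProb J τ μ φ i v)
        (fun v => sub_nonneg.2 (interimProb_mem J τ μ i v).2)
        ((integrable_const _).sub hQ)).1 (by
          rw [integral_sub (integrable_const _) hQ, hint]
          simp)
      filter_upwards [this] with v hv
      simp only [Pi.zero_apply] at hv
      linarith
  rw [lintegral_paymentBound J τ μ hφ]
  refine le_of_eq ((lintegral_congr_ae (g := fun _ => ENNReal.ofReal (revenueCurve (μ i)
    (myersonProb J φ τ μ i))) (hae.mono fun v hv => by simp only [hv])).trans ?_)
  simp

end Payment

/-! ### Comparison of the two mechanisms -/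

/-- If the random posted prices are accepted with the service probabilities of Myerson's
mechanism, raise from each agent at least what Myerson's mechanism raises when taken in isolation,
and are ordered by expected payment given acceptance, they raise half of its revenue. -/
theorem myersonRevenue_le_two_mul_randomSpmRevenue {n : ℕ} (J : Matroid (Fin n))
    {φ : Fin n → ℝ → EReal} (τ : Finset (Fin n) ↪ ℕ) (μ : Fin n → Measure ℝ)
    [∀ i, IsProbabilityMeasure (μ i)] (hμ : ∀ i, μ i (Iio 0) = 0)
    (hφ : ∀ i, Measurable (φ i)) (ν : Fin n → Measure ℝ≥0∞)
    [∀ i, IsProbabilityMeasure (ν i)] (σ : Equiv.Perm (Fin n)) (c : Fin n → ℝ≥0∞)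
    (hc : Antitone fun k => c (σ k))
    (haccept : ∀ i, ∫⁻ p, μ i {v | p ≤ ENNReal.ofReal v} ∂ν i =
      ENNReal.ofReal (myersonProb J φ τ μ i))
    (hprice : ∀ i, ∫⁻ p, p * μ i {v | p ≤ ENNReal.ofReal v} ∂ν i =
      c i * ENNReal.ofReal (myersonProb J φ τ μ i))
    (hpay : ∀ i, ∫⁻ v, paymentBound J τ μ φ i v ∂Measure.pi μ ≤
      c i * ENNReal.ofReal (myersonProb J φ τ μ i)) :
    myersonRevenue J φ τ μ ≤ 2 * randomSpmRevenue J σ ν μ := by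
  have hA : ∀ i, (ν i).prod (μ i) acceptSet = ENNReal.ofReal (myersonProb J φ τ μ i) := by
    intro i
    rw [Measure.prod_apply measurableSet_acceptSet, ← haccept]
    rfl
  have hw : ∀ i, ∫⁻ x in acceptSet, x.1 ∂(ν i).prod (μ i) =
      c i * (ν i).prod (μ i) acceptSet := by
    intro i
    rw [hA, ← hprice, ← lintegral_indicator measurableSet_acceptSet,
      lintegral_prod _ (measurable_fst.indicator measurableSet_acceptSet).aemeasurable]
    refine lintegral_congr fun p => ?_
    rw [← lintegral_indicator_const (measurableSet_le measurable_const ENNReal.measurable_ofReal)]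
    rfl
  rw [randomSpmRevenue_eq]
  calc myersonRevenue J φ τ μ
      ≤ ∑ i, ∫⁻ v, paymentBound J τ μ φ i v ∂Measure.pi μ := by
        rw [← lintegral_finsetSum _ fun i _ => measurable_paymentBound J τ μ hφ i]
        exact lintegral_mono fun v => Finset.sum_le_sum fun i _ =>
          ofReal_myersonPayment_le J τ μ hμ i v
    _ ≤ ∑ i, c i * (ν i).prod (μ i) acceptSet :=
        Finset.sum_le_sum fun i _ => (hpay i).trans_eq (by rw [hA])
    _ ≤ _ := by
        refine sum_le_two_mul_greedy J σ (fun i => (ν i).prod (μ i)) measurableSet_acceptSet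
          measurable_fst c hc hw fun S hS => ?_
        simp only [hA]
        exact sum_myersonProb_le_card J τ hφ μ S hS

/-! ### Atomless and regular distributions -/

section Atomless

variable (μ : Measure ℝ) [IsProbabilityMeasure μ]

theorem cdf_eq_zero_of_neg (hμ : μ (Iio 0) = 0) {v : ℝ} (hv : v < 0) : cdf μ v = 0 := by
  rw [cdf_eq_real, measureReal_def, measure_mono_null (Iic_subset_Iio.2 hv) hμ,
    ENNReal.toReal_zero]

variable [NullSingletonClass μ]

theorem continuous_cdf : Continuous (cdf μ) := by
  refine continuous_iff_continuousAt.2 fun v => ?_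
  rw [(monotone_cdf μ).continuousAt_iff_leftLim_eq_rightLim]
  have h : (cdf μ).measure {v} = 0 := by rw [measure_cdf]; simp
  rw [StieltjesFunction.measure_singleton, ENNReal.ofReal_eq_zero] at h
  rw [(cdf μ).rightLim_eq]
  exact le_antisymm ((monotone_cdf μ).leftLim_le le_rfl) (by linarith)

theorem cdf_quantile (hμ : μ (Iio 0) = 0) {q : ℝ} (hq : 0 < q) (hq1 : q ≤ 1) :
    cdf μ (quantile μ (1 - q)).toReal = 1 - q := by
  have htop := quantile_ne_top μ (show 1 - q < 1 by linarith)
  have hcont := (continuous_cdf μ).tendsto (quantile μ (1 - q)).toReal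
  refine le_antisymm ?_ ?_
  · refine le_of_tendsto (hcont.mono_left (nhdsWithin_le_nhds
      (s := Iio (quantile μ (1 - q)).toReal))) ?_
    filter_upwards [self_mem_nhdsWithin] with v hv
    rcases lt_or_ge v 0 with h | h
    · rw [cdf_eq_zero_of_neg μ hμ h]
      linarith
    · exact cdf_le_of_lt_quantile μ ((ENNReal.ofReal_lt_iff_lt_toReal h htop).2 hv)
  · refine ge_of_tendsto (hcont.mono_left (nhdsWithin_le_nhds
      (s := Ioi (quantile μ (1 - q)).toReal))) ?_
    filter_upwards [self_mem_nhdsWithin] with v hv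
    refine (lt_cdf_of_quantile_lt μ ?_).le
    exact (ENNReal.lt_ofReal_iff_toReal_lt htop).2 hv

theorem cdf_zero (hμ : μ (Iio 0) = 0) : cdf μ 0 = 0 := by
  rw [cdf_eq_real, measureReal_congr Iio_ae_eq_Iic.symm, measureReal_def, hμ,
    ENNReal.toReal_zero]

theorem acceptProb_quantile (hμ : μ (Iio 0) = 0) {q : ℝ} (hq : 0 ≤ q) (hq1 : q ≤ 1) :
    acceptProb μ (quantile μ (1 - q)) = q := by
  rcases hq.eq_or_lt with rfl | hq
  · rw [sub_zero, quantile_one, acceptProb_top]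
  have h := cdf_quantile μ hμ hq hq1
  rcases eq_or_ne (quantile μ (1 - q)) 0 with h0 | h0
  · rw [h0, ENNReal.toReal_zero, cdf_zero μ hμ] at h
    simp only [acceptProb, h0, zero_le, ofPred_true, probReal_univ]
    linarith
  · rw [acceptProb_eq μ h0 (quantile_ne_top μ (by linarith)), ← measureReal_congr Ioi_ae_eq_Ici]
    have := cdf_add_measureReal_Ioi μ (quantile μ (1 - q)).toReal
    linarith

end Atomless

section Regular

variable {μ : Measure ℝ} {f : ℝ → ℝ≥0}

theorem virtualValue_of_pos {w : ℝ} (hw : 0 < f w) :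
    virtualValue μ f w = ((w - (1 - cdf μ w) / f w : ℝ) : EReal) := by
  have h0 : 0 ≤ 1 - cdf μ w := sub_nonneg.2 (cdf_le_one μ w)
  have hf : (f w : ℝ≥0∞) = ENNReal.ofReal (f w) := by simp
  rw [virtualValue, hf, ← ENNReal.ofReal_div_of_pos (by exact_mod_cast hw),
    EReal.coe_ennreal_ofReal, max_eq_left (by positivity), EReal.coe_sub]

theorem virtualValue_of_eq_zero {w : ℝ} (hw : f w = 0) (h : cdf μ w < 1) :
    virtualValue μ f w = ⊥ := by
  rw [virtualValue, hw, ENNReal.coe_zero, ENNReal.div_zero (by simpa using h)]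
  simp

/-- Cleared of the quotient, the comparison gives the sign of the derivative of `(w - s)(1 - F(w))`.
It survives `f w = 0`, where a virtual value above a real number forces `F(w) = 1`. -/
theorem one_sub_cdf_le_of_le_virtualValue {s w : ℝ} (h : (s : EReal) ≤ virtualValue μ f w) :
    1 - cdf μ w ≤ (w - s) * f w := by
  rcases eq_or_ne (f w) 0 with h0 | h0
  · rcases (cdf_le_one μ w).eq_or_lt with h1 | h1
    · simp [h0, h1]
    · rw [virtualValue_of_eq_zero h0 h1] at h
      exact absurd h (by simp)
  · have hpos : 0 < f w := pos_iff_ne_zero.2 h0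
    rw [virtualValue_of_pos hpos, EReal.coe_le_coe_iff] at h
    have hpos : (0 : ℝ) < f w := by exact_mod_cast hpos
    rw [← div_le_iff₀ hpos]
    linarith

theorem le_one_sub_cdf_of_virtualValue_le {s w : ℝ} (h : virtualValue μ f w ≤ s) :
    (w - s) * f w ≤ 1 - cdf μ w := by
  rcases eq_or_ne (f w) 0 with h0 | h0
  · simp [h0, cdf_le_one μ w]
  · have hpos : 0 < f w := pos_iff_ne_zero.2 h0
    rw [virtualValue_of_pos hpos, EReal.coe_le_coe_iff] at h
    have hpos : (0 : ℝ) < f w := by exact_mod_cast hpos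
    rw [← le_div_iff₀ hpos]
    linarith

theorem measurable_virtualValue (hf : Measurable f) : Measurable (virtualValue μ f) := by
  have h1 : Measurable fun v => 1 - cdf μ v := measurable_const.sub (monotone_cdf μ).measurable
  have h2 : Measurable fun v => (ENNReal.ofReal (1 - cdf μ v) / (f v : ℝ≥0∞) : ℝ≥0∞) :=
    h1.ennreal_ofReal.div hf.coe_nnreal_ennreal
  exact measurable_coe_real_ereal.add (measurable_coe_ennreal_ereal.comp h2).neg

variable [IsProbabilityMeasure μ] (μ f)

theorem integrable_density (hf : Measurable f)
    (hμf : μ = volume.withDensity fun v => (f v : ℝ≥0∞)) : Integrable fun v => (f v : ℝ) := by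
  refine ⟨hf.coe_nnreal_real.aestronglyMeasurable, ?_⟩
  have h : ∫⁻ v, (f v : ℝ≥0∞) = 1 := by
    have := measure_univ (μ := μ)
    rwa [hμf, withDensity_apply _ MeasurableSet.univ, Measure.restrict_univ] at this
  rw [hasFiniteIntegral_iff_ofReal (ae_of_all _ fun v => (f v).coe_nonneg)]
  simp [h]

theorem cdf_sub_cdf (hf : Measurable f)
    (hμf : μ = volume.withDensity fun v => (f v : ℝ≥0∞)) (a b : ℝ) :
    cdf μ b - cdf μ a = ∫ x in a..b, (f x : ℝ) := by
  have hint := integrable_density μ f hf hμf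
  have h : ∀ v, cdf μ v = ∫ x in Iic v, (f x : ℝ) := by
    intro v
    rw [cdf_eq_real, measureReal_def]
    conv_lhs => rw [hμf]
    rw [withDensity_apply _ measurableSet_Iic, integral_eq_lintegral_of_nonneg_ae
      (ae_of_all _ fun v => (f v).coe_nonneg) hf.coe_nnreal_real.aestronglyMeasurable]
    simp
  rw [h, h, intervalIntegral.integral_Iic_sub_Iic hint.integrableOn hint.integrableOn]

/-- Since `F` is absolutely continuous with derivative `f` almost everywhere, the product rule can
be integrated. -/
theorem sub_mul_one_sub_cdf (hf : Measurable f)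
    (hμf : μ = volume.withDensity fun v => (f v : ℝ≥0∞)) (a b s : ℝ) :
    (b - s) * (1 - cdf μ b) - (a - s) * (1 - cdf μ a) =
      ∫ w in a..b, ((1 - cdf μ w) - (w - s) * f w) := by
  have hint := integrable_density μ f hf hμf
  let G : ℝ → ℝ := fun x => (1 - cdf μ a) - ∫ t in a..x, (f t : ℝ)
  have hG : ∀ x, G x = 1 - cdf μ x := fun x => by
    simp only [G, ← cdf_sub_cdf μ f hf hμf]
    ring
  have hac : AbsolutelyContinuousOnInterval G a b := by
    have h1 : AbsolutelyContinuousOnInterval (fun _ : ℝ => 1 - cdf μ a) a b :=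
      ContDiffOn.absolutelyContinuousOnInterval contDiffOn_const
    exact h1.sub
      (hint.intervalIntegrable.absolutelyContinuousOnInterval_intervalIntegral left_mem_uIcc)
  have hid : AbsolutelyContinuousOnInterval (fun x : ℝ => x - s) a b :=
    ContDiffOn.absolutelyContinuousOnInterval (by fun_prop)
  have key := hid.integral_deriv_mul_eq_sub hac
  simp only [hG] at key
  rw [← key]
  refine intervalIntegral.integral_congr_ae ?_
  filter_upwards [LocallyIntegrable.ae_hasDerivAt_integral hint.locallyIntegrable] with x hx _
  have h1 : deriv (fun x : ℝ => x - s) x = 1 := by simp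
  have h2 : deriv G x = -f x := by
    have := ((hasDerivAt_const x (1 - cdf μ a)).sub (hx a)).deriv
    rw [zero_sub] at this
    exact this
  rw [h1, h2]
  ring

variable {μ f}

/-- The revenue curve of a regular distribution has a supporting line at every interior point. -/
theorem exists_supporting_line_of_isRegular (hμ : μ (Iio 0) = 0) (hf : Measurable f)
    (hμf : μ = volume.withDensity fun v => (f v : ℝ≥0∞)) (hreg : IsRegular μ f)
    {q : ℝ} (hq : 0 < q) (hq1 : q < 1) :
    ∃ s : ℝ, ∀ r ∈ Icc (0 : ℝ) 1, revenueCurve μ r ≤ revenueCurve μ q + s * (r - q) := by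
  have : NullSingletonClass μ := by
    rw [hμf]
    infer_instance
  set v₀ : ℝ := (quantile μ (1 - q)).toReal with hv₀
  have hv₀0 : 0 ≤ v₀ := ENNReal.toReal_nonneg
  have hF₀ : cdf μ v₀ = 1 - q := cdf_quantile μ hμ hq hq1.le
  -- Otherwise the virtual value is `-∞` at `v₀`, hence by monotonicity on `[0, v₀]`. Then `f`
  -- vanishes there and `F(v₀) = 0`, against `F(v₀) = 1 - q > 0`.
  have hpos : 0 < f v₀ := by
    by_contra hneg
    have h0 : virtualValue μ f v₀ = ⊥ :=
      virtualValue_of_eq_zero (le_antisymm (not_lt.1 hneg) bot_le) (by linarith)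
    have hz : ∀ w ∈ Icc 0 v₀, f w = 0 := by
      intro w hw
      by_contra hne
      have := hreg hw.1 hv₀0 hw.2
      rw [h0, virtualValue_of_pos (pos_iff_ne_zero.2 hne)] at this
      exact EReal.coe_ne_bot _ (le_bot_iff.1 this)
    have h1 := cdf_sub_cdf μ f hf hμf 0 v₀
    rw [intervalIntegral.integral_congr (g := fun _ => (0 : ℝ)) fun w hw => by
      rw [uIcc_of_le hv₀0] at hw
      simp [hz w hw], cdf_zero μ hμ, hF₀] at h1
    simp at h1
    linarith
  have hs := virtualValue_of_pos (μ := μ) hpos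
  set s : ℝ := v₀ - (1 - cdf μ v₀) / f v₀ with hsdef
  have hsv : s ≤ v₀ := by
    have : 0 ≤ (1 - cdf μ v₀) / f v₀ := by
      have := cdf_le_one μ v₀
      exact div_nonneg (by linarith) (f v₀).2
    linarith
  -- With `s` the virtual value at `v₀`, regularity makes `(v - s)(1 - F(v))` rise before `v₀` and
  -- fall after it. At `v = F⁻¹(1 - r)` this function is `R(r) - s r`.
  have hmax : ∀ v, 0 ≤ v → (v - s) * (1 - cdf μ v) ≤ (v₀ - s) * (1 - cdf μ v₀) := by
    intro v hv
    rcases le_total v v₀ with h | h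
    · have key := sub_mul_one_sub_cdf μ f hf hμf v v₀ s
      have : 0 ≤ ∫ w in v..v₀, ((1 - cdf μ w) - (w - s) * f w) := by
        refine intervalIntegral.integral_nonneg h fun w hw => sub_nonneg.2 ?_
        refine le_one_sub_cdf_of_virtualValue_le ?_
        rw [← hs]
        exact hreg (hv.trans hw.1) hv₀0 hw.2
      linarith
    · have key := sub_mul_one_sub_cdf μ f hf hμf v₀ v s
      have : 0 ≤ ∫ w in v₀..v, -((1 - cdf μ w) - (w - s) * f w) := by
        refine intervalIntegral.integral_nonneg h fun w hw => neg_nonneg.2 (sub_nonpos.2 ?_)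
        refine one_sub_cdf_le_of_le_virtualValue ?_
        rw [← hs]
        exact hreg hv₀0 (hv₀0.trans hw.1) hw.1
      rw [intervalIntegral.integral_neg] at this
      linarith
  refine ⟨s, fun r hr => ?_⟩
  rw [hF₀] at hmax
  have hRq : revenueCurve μ q = q * v₀ := rfl
  rcases hr.1.eq_or_lt with rfl | hr0
  · rw [revenueCurve_zero, hRq]
    nlinarith
  · have h := hmax (quantile μ (1 - r)).toReal ENNReal.toReal_nonneg
    rw [cdf_quantile μ hμ hr0 hr.2] at h
    have hRr : revenueCurve μ r = r * (quantile μ (1 - r)).toReal := rfl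
    rw [hRr, hRq]
    linarith

end Regular

/-! ### Ironing -/

theorem exists_supporting_line_of_concaveOn {g : ℝ → ℝ} {S : Set ℝ} (hg : ConcaveOn ℝ S g) {q : ℝ}
    (hq : q ∈ interior S) : ∃ s : ℝ, ∀ r ∈ S, g r ≤ g q + s * (r - q) := by
  have hc := hg.neg
  refine ⟨-derivWithin (-g) (Ioi q) q, fun r hr => ?_⟩
  rcases lt_trichotomy r q with h | rfl | h
  · have h1 := (hc.slope_le_leftDeriv_of_mem_interior hr hq h).trans
      (hc.leftDeriv_le_rightDeriv_of_mem_interior hq)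
    rw [slope_def_field, div_le_iff₀ (by linarith)] at h1
    simp only [Pi.neg_apply] at h1
    linarith
  · simp
  · have h1 := hc.rightDeriv_le_slope_of_mem_interior hq hr h
    rw [slope_def_field, le_div_iff₀ (by linarith)] at h1
    simp only [Pi.neg_apply] at h1
    linarith

theorem concaveOn_affine (y s q : ℝ) (S : Set ℝ) (hS : Convex ℝ S) :
    ConcaveOn ℝ S fun r => y + s * (r - q) := by
  refine ⟨hS, fun a _ b _ α β _ _ hαβ => le_of_eq ?_⟩
  simp only [smul_eq_mul]
  linear_combination (y - s * q) * hαβ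

section IronedCurve

variable (μ : Measure ℝ)

theorem ironedRevenueCurve_le {g : ℝ → ℝ} (hg : ConcaveOn ℝ (Icc 0 1) g)
    (hle : ∀ r ∈ Icc (0 : ℝ) 1, revenueCurve μ r ≤ g r) {q : ℝ} (hq : q ∈ Icc (0 : ℝ) 1) :
    ironedRevenueCurve μ q ≤ g q := by
  refine csInf_le ⟨revenueCurve μ q, ?_⟩ ⟨g, hg, hle, rfl⟩
  rintro y ⟨h, -, hh, rfl⟩
  exact hh q hq

variable {μ} (hb : ∃ C : ℝ, ∀ r ∈ Icc (0 : ℝ) 1, revenueCurve μ r ≤ C)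

include hb

theorem nonempty_concave_majorant_values (q : ℝ) :
    {y | ∃ g : ℝ → ℝ, ConcaveOn ℝ (Icc 0 1) g ∧
      (∀ r ∈ Icc (0 : ℝ) 1, revenueCurve μ r ≤ g r) ∧ g q = y}.Nonempty := by
  obtain ⟨C, hC⟩ := hb
  exact ⟨C, fun _ => C, concaveOn_const C (convex_Icc 0 1), hC, rfl⟩

theorem revenueCurve_le_ironedRevenueCurve {q : ℝ} (hq : q ∈ Icc (0 : ℝ) 1) :
    revenueCurve μ q ≤ ironedRevenueCurve μ q := by
  refine le_csInf (nonempty_concave_majorant_values hb q) ?_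
  rintro y ⟨g, -, hg, rfl⟩
  exact hg q hq

theorem concaveOn_ironedRevenueCurve : ConcaveOn ℝ (Icc 0 1) (ironedRevenueCurve μ) := by
  refine ⟨convex_Icc 0 1, fun a ha b hb' α β hα hβ hαβ => ?_⟩
  refine le_csInf (nonempty_concave_majorant_values hb _) ?_
  rintro y ⟨g, hg, hle, rfl⟩
  refine le_trans ?_ (hg.2 ha hb' hα hβ hαβ)
  simp only [smul_eq_mul]
  exact add_le_add (mul_le_mul_of_nonneg_left (ironedRevenueCurve_le μ hg hle ha) hα)
    (mul_le_mul_of_nonneg_left (ironedRevenueCurve_le μ hg hle hb') hβ)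

theorem monotone_ironedVirtualValue : Monotone (ironedVirtualValue μ) := by
  intro v w hvw
  rcases (monotone_cdf μ hvw).eq_or_lt with h | h
  · simp [ironedVirtualValue, h]
  refine iSup₂_le fun r hr => ?_
  have ha : 1 - cdf μ w ∈ Icc (0 : ℝ) 1 :=
    ⟨sub_nonneg.2 (cdf_le_one μ w), sub_le_self _ (cdf_nonneg μ w)⟩
  have hr' : r ∈ Icc (0 : ℝ) 1 :=
    ⟨(sub_nonneg.2 (cdf_le_one μ v)).trans hr.1.le, hr.2⟩
  have hab : 1 - cdf μ w < 1 - cdf μ v := by linarith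
  -- The same right endpoint `r` serves for `w`: chords of a concave function to a fixed right end
  -- get steeper as the left end moves left.
  refine le_iSup₂_of_le r ⟨hab.trans hr.1, hr.2⟩ ?_
  have hs := (concaveOn_ironedRevenueCurve hb).slope_anti_adjacent ha hr' hab hr.1
  have h1 : 0 < r - (1 - cdf μ v) := sub_pos.2 hr.1
  have h2 : 0 < (1 - cdf μ v) - (1 - cdf μ w) := sub_pos.2 hab
  rw [div_le_div_iff₀ h1 h2] at hs
  rw [EReal.coe_le_coe_iff, div_le_div_iff₀ h1 (by linarith)]
  linarith

/-- Where the ironed revenue curve is affine, the ironed virtual value is its slope. -/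
theorem ironedVirtualValue_eq_of_affine {q q₁ q₂ s : ℝ} (hq₂ : q₂ ∈ Icc (0 : ℝ) 1)
    (hq₁ : q₁ ∈ Icc (0 : ℝ) 1)
    (hs : ∀ r ∈ Icc (0 : ℝ) 1, ironedRevenueCurve μ r ≤ ironedRevenueCurve μ q + s * (r - q))
    (h₂ : revenueCurve μ q₂ = ironedRevenueCurve μ q + s * (q₂ - q))
    (h₁ : revenueCurve μ q₁ = ironedRevenueCurve μ q + s * (q₁ - q)) {v : ℝ}
    (hv₁ : quantile μ (1 - q₁) < ENNReal.ofReal v)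
    (hv₂ : ENNReal.ofReal v < quantile μ (1 - q₂)) : ironedVirtualValue μ v = s := by
  have hα₁ : 1 - cdf μ v < q₁ := by linarith [lt_cdf_of_quantile_lt μ hv₁]
  have hα₂ : q₂ ≤ 1 - cdf μ v := by linarith [cdf_le_of_lt_quantile μ hv₂]
  unfold ironedVirtualValue
  set α := 1 - cdf μ v
  -- The line bounds the curve from above everywhere, and concavity between the two contact points
  -- bounds it from below.
  have hlin : ∀ r ∈ Icc q₂ q₁,
      ironedRevenueCurve μ r = ironedRevenueCurve μ q + s * (r - q) := by
    intro r hr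
    refine le_antisymm (hs r ⟨hq₂.1.trans hr.1, hr.2.trans hq₁.2⟩) ?_
    have hpos : 0 < q₁ - q₂ := by linarith
    have hconc := (concaveOn_ironedRevenueCurve hb).2 hq₂ hq₁
      (show 0 ≤ (q₁ - r) / (q₁ - q₂) from div_nonneg (by linarith [hr.2]) hpos.le)
      (show 0 ≤ (r - q₂) / (q₁ - q₂) from div_nonneg (by linarith [hr.1]) hpos.le)
      (by field_simp; ring)
    simp only [smul_eq_mul] at hconc
    rw [show (q₁ - r) / (q₁ - q₂) * q₂ + (r - q₂) / (q₁ - q₂) * q₁ = r by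
      field_simp; ring] at hconc
    refine le_trans ?_ hconc
    have e₂ := revenueCurve_le_ironedRevenueCurve hb hq₂
    have e₁ := revenueCurve_le_ironedRevenueCurve hb hq₁
    rw [h₂] at e₂
    rw [h₁] at e₁
    calc ironedRevenueCurve μ q + s * (r - q)
        = (q₁ - r) / (q₁ - q₂) * (ironedRevenueCurve μ q + s * (q₂ - q)) +
          (r - q₂) / (q₁ - q₂) * (ironedRevenueCurve μ q + s * (q₁ - q)) := by
          field_simp
          ring
      _ ≤ _ := add_le_add
          (mul_le_mul_of_nonneg_left e₂ (div_nonneg (by linarith [hr.2]) hpos.le))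
          (mul_le_mul_of_nonneg_left e₁ (div_nonneg (by linarith [hr.1]) hpos.le))
  have hα := hlin α ⟨hα₂, hα₁.le⟩
  refine le_antisymm (iSup₂_le fun r hr => ?_) (le_iSup₂_of_le q₁ ⟨hα₁, hq₁.2⟩ ?_)
  · have := hs r ⟨(hq₂.1.trans hα₂).trans hr.1.le, hr.2⟩
    rw [EReal.coe_le_coe_iff, div_le_iff₀ (sub_pos.2 hr.1), hα]
    linarith
  · rw [EReal.coe_le_coe_iff, le_div_iff₀ (sub_pos.2 hα₁), hα,
      hlin q₁ ⟨hα₂.trans hα₁.le, le_rfl⟩]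
    linarith

omit hb in
/-- A supporting line of the ironed revenue curve at `q` touches the revenue curve on either side
of `q`: otherwise it could be tilted to a smaller concave majorant. -/
theorem exists_contact (husc : UpperSemicontinuousOn (revenueCurve μ) (Icc 0 1)) {q s : ℝ}
    (hq : q ∈ Icc (0 : ℝ) 1)
    (hs : ∀ r ∈ Icc (0 : ℝ) 1, revenueCurve μ r ≤ ironedRevenueCurve μ q + s * (r - q))
    (a : ℝ) : ∃ r ∈ Icc (0 : ℝ) 1, a * (r - q) ≤ 0 ∧
      revenueCurve μ r = ironedRevenueCurve μ q + s * (r - q) := by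
  by_contra! hne
  set y := ironedRevenueCurve μ q with hy
  have husc_add : ∀ c d : ℝ, UpperSemicontinuousOn
      (fun r => revenueCurve μ r + (c + d * (r - q))) (Icc 0 1) := fun c d =>
    husc.add (Continuous.continuousOn (by fun_prop)).upperSemicontinuousOn
  -- `K` is the side of `q` assumed to be without contact. Upper semicontinuity on a compact set
  -- leaves a uniform gap `d` there.
  set K : Set ℝ := Icc 0 1 ∩ {r | a * (r - q) ≤ 0} with hK
  have hKc : IsCompact K :=
    isCompact_Icc.inter_right (isClosed_le (by fun_prop) continuous_const)
  have hKq : q ∈ K := ⟨hq, by simp⟩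
  obtain ⟨r₁, hr₁, hmax₁⟩ := ((husc_add (-y) (-s)).mono inter_subset_left).exists_isMaxOn
    ⟨q, hKq⟩ hKc
  set d : ℝ := -(revenueCurve μ r₁ + (-y + -s * (r₁ - q))) with hd
  have hdpos : 0 < d := by
    have := lt_of_le_of_ne (hs r₁ hr₁.1) (hne r₁ hr₁.1 hr₁.2)
    linarith
  have hKd : ∀ r ∈ K, revenueCurve μ r - y - s * (r - q) ≤ -d := fun r hr => by
    have := isMaxOn_iff.1 hmax₁ r hr
    linarith
  obtain ⟨ε, hε, hεa⟩ : ∃ ε : ℝ, 0 < ε ∧ ε * |a| < d := by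
    refine ⟨d / (2 * (|a| + 1)), by positivity, ?_⟩
    rw [div_mul_eq_mul_div, div_lt_iff₀ (by positivity)]
    nlinarith [abs_nonneg a]
  -- Adding `ε * a` to the slope lowers the line by less than `d` on `K` and raises it strictly off
  -- `K`. The tilted line, still of height `y` at `q`, now has a gap `m` everywhere and can be
  -- lowered by `m`.
  have hneg : ∀ r ∈ Icc (0 : ℝ) 1,
      revenueCurve μ r + (-y + -(s + ε * a) * (r - q)) < 0 := by
    intro r hr
    by_cases hrK : a * (r - q) ≤ 0
    · have h1 := hKd r ⟨hr, hrK⟩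
      have h2 : -(a * (r - q)) ≤ |a| := by
        calc -(a * (r - q)) ≤ |a * (r - q)| := neg_le_abs _
          _ = |a| * |r - q| := abs_mul _ _
          _ ≤ |a| * 1 := by
              gcongr
              rw [abs_le]
              constructor <;> linarith [hr.1, hr.2, hq.1, hq.2]
          _ = |a| := mul_one _
      nlinarith
    · have h1 := hs r hr
      have h2 := mul_pos hε (not_le.1 hrK)
      linarith
  obtain ⟨r₂, hr₂, hmax₂⟩ := (husc_add (-y) (-(s + ε * a))).exists_isMaxOn ⟨q, hq⟩ isCompact_Icc
  set m : ℝ := -(revenueCurve μ r₂ + (-y + -(s + ε * a) * (r₂ - q))) with hm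
  have hmpos : 0 < m := by
    have := hneg r₂ hr₂
    linarith
  have := ironedRevenueCurve_le μ
    (concaveOn_affine (y - m) (s + ε * a) q (Icc 0 1) (convex_Icc 0 1))
    (fun r hr => by
      have := isMaxOn_iff.1 hmax₂ r hr
      linarith) hq
  rw [← hy] at this
  simp only [sub_self, mul_zero, add_zero] at this
  linarith

end IronedCurve

section Tail

variable {μ : Measure ℝ} [IsProbabilityMeasure μ]
  (htail : Tendsto (fun v : ℝ => v * μ.real (Ici v)) atTop (𝓝 0))

include htail

/-- A price at most `M` contributes at most `M * r`. For a larger price `p`, the revenue is at most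
`p * Pr[v ≥ p]`, which the tail condition makes smaller than `ε`. -/
theorem exists_revenueCurve_le_add {ε : ℝ} (hε : 0 < ε) :
    ∃ M : ℝ, 0 < M ∧ ∀ r ∈ Icc (0 : ℝ) 1, revenueCurve μ r ≤ ε + M * r := by
  obtain ⟨M, hM⟩ := eventually_atTop.1 (htail.eventually_lt_const hε)
  refine ⟨max M 1, by positivity, fun r hr => ?_⟩
  rcases hr.1.eq_or_lt with rfl | hr0
  · simpa [revenueCurve] using hε.le
  have htop := quantile_ne_top μ (show 1 - r < 1 by linarith)
  rw [revenueCurve]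
  rcases le_or_gt (quantile μ (1 - r)).toReal (max M 1) with h | h
  · have := mul_le_mul_of_nonneg_left h hr0.le
    linarith
  · have h0 : quantile μ (1 - r) ≠ 0 := by
      intro h0
      rw [h0, ENNReal.toReal_zero] at h
      linarith [le_max_right M 1]
    have h1 := le_acceptProb_quantile μ hr0 hr.2
    rw [acceptProb_eq μ h0 htop] at h1
    have h2 := hM _ ((le_max_left M 1).trans h.le)
    have h3 := mul_le_mul_of_nonneg_right h1 (ENNReal.toReal_nonneg (a := quantile μ (1 - r)))
    have h4 : 0 ≤ max M 1 * r := by positivity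
    linarith

theorem exists_revenueCurve_le : ∃ C : ℝ, ∀ r ∈ Icc (0 : ℝ) 1, revenueCurve μ r ≤ C := by
  obtain ⟨M, hM, h⟩ := exists_revenueCurve_le_add htail one_pos
  refine ⟨1 + M, fun r hr => (h r hr).trans ?_⟩
  nlinarith [hr.2]

/-- At `0` this is the tail condition. At `q > 0`, a `v` just above the quantile price has `F(v) > 1
- q`; this persists for `r` near `q`, so `v` also bounds the nearby prices. -/
theorem upperSemicontinuousOn_revenueCurve :
    UpperSemicontinuousOn (revenueCurve μ) (Icc 0 1) := by
  intro q hq c hc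
  rcases hq.1.eq_or_lt with rfl | hq0
  · rw [revenueCurve_zero] at hc
    obtain ⟨M, hM, h⟩ := exists_revenueCurve_le_add htail (half_pos hc)
    have hev : ∀ᶠ r in 𝓝[Icc 0 1] (0 : ℝ), c / 2 + M * r < c := by
      refine nhdsWithin_le_nhds (ContinuousAt.eventually_lt (by fun_prop) continuousAt_const ?_)
      linarith
    filter_upwards [hev, self_mem_nhdsWithin] with r h1 h2
    exact (h r h2).trans_lt h1
  · have htop := quantile_ne_top μ (show 1 - q < 1 by linarith)
    obtain ⟨v, hv, hvc⟩ : ∃ v, (quantile μ (1 - q)).toReal < v ∧ q * v < c := by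
      refine ⟨((quantile μ (1 - q)).toReal + c / q) / 2, ?_, ?_⟩
      · have : (quantile μ (1 - q)).toReal < c / q := by
          rw [lt_div_iff₀ hq0, mul_comm]
          exact hc
        linarith
      · have h1 : q * (quantile μ (1 - q)).toReal < c := hc
        have h2 : q * (c / q) = c := by field_simp
        linarith
    have hcdf : 1 - cdf μ v < q := by
      have := lt_cdf_of_quantile_lt μ ((ENNReal.lt_ofReal_iff_toReal_lt htop).2 hv)
      linarith
    have hv0 : 0 ≤ v := ENNReal.toReal_nonneg.trans hv.le
    have h1 : ∀ᶠ r in 𝓝[Icc 0 1] q, 1 - cdf μ v < r :=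
      nhdsWithin_le_nhds (eventually_gt_nhds hcdf)
    have h2 : ∀ᶠ r in 𝓝[Icc 0 1] q, r * v < c :=
      nhdsWithin_le_nhds (ContinuousAt.eventually_lt (by fun_prop) continuousAt_const hvc)
    filter_upwards [h1, h2, self_mem_nhdsWithin] with r hr1 hr2 hr
    refine lt_of_le_of_lt (mul_le_mul_of_nonneg_left ?_ hr.1) hr2
    exact ENNReal.toReal_le_of_le_ofReal hv0 (quantile_le_ofReal μ (by linarith))

/-- For every service probability there are two prices whose mixture attains the ironed revenue
curve. -/
theorem exists_ironing_mixture {q : ℝ} (hq : q ∈ Icc (0 : ℝ) 1) :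
    ∃ x q₁ q₂ : ℝ, (x ∈ Icc 0 1 ∧ 0 ≤ q₂ ∧ q₂ ≤ q ∧ q ≤ q₁ ∧ q₁ ≤ 1 ∧
        x * q₁ + (1 - x) * q₂ = q) ∧
      (∀ v w : ℝ, quantile μ (1 - q₁) < ENNReal.ofReal v →
        ENNReal.ofReal v < quantile μ (1 - q₂) → quantile μ (1 - q₁) < ENNReal.ofReal w →
        ENNReal.ofReal w < quantile μ (1 - q₂) →
        ironedVirtualValue μ v = ironedVirtualValue μ w) ∧
      (ConcaveOn ℝ (Icc 0 1) (revenueCurve μ) → q₁ = q ∧ q₂ = q) ∧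
      ((q = 0 ∨ q = 1) → q₁ = q ∧ q₂ = q) ∧
      (0 < q → q < 1 → ∃ s : ℝ, ∀ r ∈ Icc (0 : ℝ) 1,
        revenueCurve μ r ≤ x * revenueCurve μ q₁ + (1 - x) * revenueCurve μ q₂ + s * (r - q)) := by
  by_cases htriv : ConcaveOn ℝ (Icc 0 1) (revenueCurve μ) ∨ q = 0 ∨ q = 1
  · refine ⟨1, q, q, ⟨by simp, hq.1, le_rfl, le_rfl, hq.2, by ring⟩,
      fun v w h1 h2 => absurd (h1.trans h2) (lt_irrefl _), fun _ => ⟨rfl, rfl⟩,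
      fun _ => ⟨rfl, rfl⟩, fun h0 h1 => ?_⟩
    rcases htriv with h | h | h
    · obtain ⟨s, hs⟩ := exists_supporting_line_of_concaveOn h (q := q) (by
        rw [interior_Icc]
        exact ⟨h0, h1⟩)
      exact ⟨s, fun r hr => by simpa using hs r hr⟩
    · linarith
    · linarith
  · push Not at htriv
    obtain ⟨hnc, hq0, hq1⟩ := htriv
    have h0 : 0 < q := lt_of_le_of_ne hq.1 hq0.symm
    have h1 : q < 1 := lt_of_le_of_ne hq.2 hq1
    have hb := exists_revenueCurve_le htail
    obtain ⟨s, hs⟩ := exists_supporting_line_of_concaveOn (concaveOn_ironedRevenueCurve hb)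
      (q := q) (by
        rw [interior_Icc]
        exact ⟨h0, h1⟩)
    have hsR : ∀ r ∈ Icc (0 : ℝ) 1,
        revenueCurve μ r ≤ ironedRevenueCurve μ q + s * (r - q) := fun r hr =>
      (revenueCurve_le_ironedRevenueCurve hb hr).trans (hs r hr)
    have husc := upperSemicontinuousOn_revenueCurve htail
    -- The sign `1` selects a contact point to the left of `q`, the sign `-1` one to the right.
    obtain ⟨q₂, hq₂, hle₂, hc₂⟩ := exists_contact husc hq hsR 1
    obtain ⟨q₁, hq₁, hle₁, hc₁⟩ := exists_contact husc hq hsR (-1)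
    have hle₂ : q₂ ≤ q := by linarith
    have hle₁ : q ≤ q₁ := by linarith
    obtain ⟨x, hx, hxq⟩ : ∃ x ∈ Icc (0 : ℝ) 1, x * q₁ + (1 - x) * q₂ = q := by
      have : q ∈ segment ℝ q₂ q₁ := by
        rw [segment_eq_Icc (hle₂.trans hle₁)]
        exact ⟨hle₂, hle₁⟩
      obtain ⟨a, b, ha, hb, hab, h⟩ := this
      refine ⟨b, ⟨hb, by linarith⟩, ?_⟩
      rw [← h, ← hab]
      simp only [smul_eq_mul]
      ring
    refine ⟨x, q₁, q₂, ⟨hx, hq₂.1, hle₂, hle₁, hq₁.2, hxq⟩, fun v w hv₁ hv₂ hw₁ hw₂ => ?_,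
      fun h => absurd h hnc, fun h => ?_, fun _ _ => ⟨s, fun r hr => ?_⟩⟩
    · rw [ironedVirtualValue_eq_of_affine hb hq₂ hq₁ hs hc₂ hc₁ hv₁ hv₂,
        ironedVirtualValue_eq_of_affine hb hq₂ hq₁ hs hc₂ hc₁ hw₁ hw₂]
    · tauto
    · rw [hc₁, hc₂]
      have := hsR r hr
      have e : x * (ironedRevenueCurve μ q + s * (q₁ - q)) +
          (1 - x) * (ironedRevenueCurve μ q + s * (q₂ - q)) = ironedRevenueCurve μ q := by
        linear_combination s * hxq
      linarith

end Tail

/-! ### Price lotteries -/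

section Lottery

variable (μ : Measure ℝ) [IsProbabilityMeasure μ]

/-- For `q = 0` the proposal is `∞` and the quotient is `0 / 0 = 0`, so no offer is made, which is
the same as offering `∞`. -/
theorem offerProb_mem {q : ℝ} (hq : q ∈ Icc (0 : ℝ) 1) :
    q / acceptProb μ (quantile μ (1 - q)) ∈ Icc (0 : ℝ) 1 := by
  rcases hq.1.eq_or_lt with rfl | h
  · simp
  · have := le_acceptProb_quantile μ h hq.2
    exact ⟨div_nonneg hq.1 (hq.1.trans this), div_le_one_of_le₀ this (hq.1.trans this)⟩

theorem offerProb_mul {q : ℝ} (hq : q ∈ Icc (0 : ℝ) 1) :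
    q / acceptProb μ (quantile μ (1 - q)) * acceptProb μ (quantile μ (1 - q)) = q := by
  rcases hq.1.eq_or_lt with rfl | h
  · simp
  · have := le_acceptProb_quantile μ h hq.2
    exact div_mul_cancel₀ _ (by linarith)

theorem measure_accept_eq (p : ℝ≥0∞) :
    μ {v | p ≤ ENNReal.ofReal v} = ENNReal.ofReal (acceptProb μ p) := by
  rw [acceptProb, ofReal_measureReal]

variable {x q₁ q₂ : ℝ} (hx : x ∈ Icc (0 : ℝ) 1) (hq₁ : q₁ ∈ Icc (0 : ℝ) 1)
  (hq₂ : q₂ ∈ Icc (0 : ℝ) 1)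

include hx hq₁ hq₂

theorem isProbabilityMeasure_priceLottery : IsProbabilityMeasure (priceLottery μ x q₁ q₂) := by
  have h1 := offerProb_mem μ hq₁
  have h2 := offerProb_mem μ hq₂
  refine ⟨?_⟩
  simp only [priceLottery, Measure.add_apply, Measure.smul_apply, measure_univ, smul_eq_mul,
    mul_one]
  have e1 := mul_nonneg hx.1 h1.1
  have e2 := mul_nonneg (sub_nonneg.2 hx.2) h2.1
  rw [← ENNReal.ofReal_add e1 e2, ← ENNReal.ofReal_add (add_nonneg e1 e2)]
  · rw [← ENNReal.ofReal_one]
    congr 1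
    ring
  · have := mul_le_mul_of_nonneg_left h1.2 hx.1
    have := mul_le_mul_of_nonneg_left h2.2 (sub_nonneg.2 hx.2)
    linarith

theorem lintegral_priceLottery_accept :
    ∫⁻ p, μ {v | p ≤ ENNReal.ofReal v} ∂priceLottery μ x q₁ q₂ =
      ENNReal.ofReal (x * q₁ + (1 - x) * q₂) := by
  have h1 := offerProb_mem μ hq₁
  have h2 := offerProb_mem μ hq₂
  have e1 := mul_nonneg hx.1 h1.1
  have e2 := mul_nonneg (sub_nonneg.2 hx.2) h2.1
  simp only [measure_accept_eq, priceLottery, lintegral_add_measure, lintegral_smul_measure,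
    lintegral_dirac, acceptProb_top, ENNReal.ofReal_zero, smul_eq_mul, mul_zero, add_zero]
  rw [← ENNReal.ofReal_mul e1, ← ENNReal.ofReal_mul e2, mul_assoc, offerProb_mul μ hq₁,
    mul_assoc, offerProb_mul μ hq₂, ← ENNReal.ofReal_add (mul_nonneg hx.1 hq₁.1)
    (mul_nonneg (sub_nonneg.2 hx.2) hq₂.1)]

theorem lintegral_priceLottery_price :
    ∫⁻ p, p * μ {v | p ≤ ENNReal.ofReal v} ∂priceLottery μ x q₁ q₂ =
      ENNReal.ofReal (x * revenueCurve μ q₁ + (1 - x) * revenueCurve μ q₂) := by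
  have h1 := offerProb_mem μ hq₁
  have h2 := offerProb_mem μ hq₂
  have e1 := mul_nonneg hx.1 h1.1
  have e2 := mul_nonneg (sub_nonneg.2 hx.2) h2.1
  simp only [measure_accept_eq, priceLottery, lintegral_add_measure, lintegral_smul_measure,
    lintegral_dirac, acceptProb_top, ENNReal.ofReal_zero, smul_eq_mul, mul_zero, add_zero]
  rw [mul_left_comm, ← ENNReal.ofReal_mul e1, mul_assoc, offerProb_mul μ hq₁,
    mul_left_comm (ENNReal.ofReal ((1 - x) * _)), ← ENNReal.ofReal_mul e2, mul_assoc (1 - x),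
    offerProb_mul μ hq₂, ENNReal.ofReal_mul hx.1, ENNReal.ofReal_mul (sub_nonneg.2 hx.2),
    mul_left_comm, ← ofReal_revenueCurve μ hq₁.1, mul_left_comm, ← ofReal_revenueCurve μ hq₂.1,
    ← ENNReal.ofReal_mul hx.1, ← ENNReal.ofReal_mul (sub_nonneg.2 hx.2),
    ← ENNReal.ofReal_add (mul_nonneg hx.1 (revenueCurve_nonneg μ hq₁.1))
      (mul_nonneg (sub_nonneg.2 hx.2) (revenueCurve_nonneg μ hq₂.1))]

end Lottery

end BSMD

end

theorem mainTheorem1 (n : ℕ) (J : Matroid (Fin n)) (τ : Finset (Fin n) ↪ ℕ)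
    (μ : Fin n → Measure ℝ) [∀ i, IsProbabilityMeasure (μ i)]
    (hμ : ∀ i, μ i (Iio 0) = 0) :
    -- regular distributions with densities
    (∀ f : Fin n → ℝ → ℝ≥0, (∀ i, Measurable (f i)) →
      (∀ i, μ i = volume.withDensity fun v => (f i v : ℝ≥0∞)) →
      (∀ i, BSMD.IsRegular (μ i) (f i)) →
      let φ : Fin n → ℝ → EReal := fun i => BSMD.virtualValue (μ i) (f i)
      let p : Fin n → ℝ≥0∞ :=
        fun i => BSMD.quantile (μ i) (1 - BSMD.myersonProb J φ τ μ i)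
      ∀ σ : Equiv.Perm (Fin n), Antitone (fun k => p (σ k)) →
        BSMD.myersonRevenue J φ τ μ ≤ 2 * BSMD.spmRevenue J σ p μ) ∧
    -- arbitrary distributions: ironed virtual values and random prices
    ((∀ i, Tendsto (fun v : ℝ => v * (μ i).real (Ici v)) atTop (𝓝 0)) →
      let φ : Fin n → ℝ → EReal := fun i => BSMD.ironedVirtualValue (μ i)
      let q : Fin n → ℝ := fun i => BSMD.myersonProb J φ τ μ i
      ∃ x q₁ q₂ : Fin n → ℝ,
        (∀ i, x i ∈ Icc 0 1 ∧ 0 ≤ q₂ i ∧ q₂ i ≤ q i ∧ q i ≤ q₁ i ∧ q₁ i ≤ 1 ∧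
          x i * q₁ i + (1 - x i) * q₂ i = q i) ∧
        (∀ i, ∀ v w : ℝ,
          BSMD.quantile (μ i) (1 - q₁ i) < ENNReal.ofReal v →
          ENNReal.ofReal v < BSMD.quantile (μ i) (1 - q₂ i) →
          BSMD.quantile (μ i) (1 - q₁ i) < ENNReal.ofReal w →
          ENNReal.ofReal w < BSMD.quantile (μ i) (1 - q₂ i) → φ i v = φ i w) ∧
        (∀ i, ConcaveOn ℝ (Icc 0 1) (BSMD.revenueCurve (μ i)) → q₁ i = q i ∧ q₂ i = q i) ∧
        ∀ σ : Equiv.Perm (Fin n),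
          Antitone (fun k =>
            (x (σ k) * BSMD.revenueCurve (μ (σ k)) (q₁ (σ k)) +
              (1 - x (σ k)) * BSMD.revenueCurve (μ (σ k)) (q₂ (σ k))) / q (σ k)) →
          BSMD.myersonRevenue J φ τ μ ≤ 2 * BSMD.randomSpmRevenue J σ
            (fun i => BSMD.priceLottery (μ i) (x i) (q₁ i) (q₂ i)) μ) := by
  constructor
  · intro f hf hμf hreg φ p σ hσ
    have hna : ∀ i, NullSingletonClass (μ i) := fun i => by
      rw [hμf i]
      infer_instance
    have hφ : ∀ i, Measurable (φ i) := fun i => BSMD.measurable_virtualValue (hf i)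
    have hq : ∀ i, BSMD.myersonProb J φ τ μ i ∈ Icc (0 : ℝ) 1 := BSMD.myersonProb_mem J τ μ
    have haccept : ∀ i, μ i {v | p i ≤ ENNReal.ofReal v} =
        ENNReal.ofReal (BSMD.myersonProb J φ τ μ i) := fun i => by
      rw [BSMD.measure_accept_eq, BSMD.acceptProb_quantile (μ i) (hμ i) (hq i).1 (hq i).2]
    -- Fixed prices are treated as degenerate lotteries, so that one comparison serves both cases.
    rw [← BSMD.randomSpmRevenue_dirac]
    refine BSMD.myersonRevenue_le_two_mul_randomSpmRevenue J τ μ hμ hφ _ σ p hσ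
      (fun i => ?_) (fun i => ?_) (fun i => ?_)
    · rw [lintegral_dirac, haccept]
    · rw [lintegral_dirac, haccept]
    · rw [← BSMD.ofReal_revenueCurve (μ i) (hq i).1]
      by_cases hex : BSMD.myersonProb J φ τ μ i = 0 ∨ BSMD.myersonProb J φ τ μ i = 1
      · exact BSMD.lintegral_paymentBound_le_of_extreme J τ μ hφ i hex
      · push Not at hex
        obtain ⟨s, hs⟩ := BSMD.exists_supporting_line_of_isRegular (hμ i) (hf i) (hμf i) (hreg i)
          (lt_of_le_of_ne (hq i).1 hex.1.symm) (lt_of_le_of_ne (hq i).2 hex.2)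
        exact BSMD.lintegral_paymentBound_le_affine J τ μ hφ i _ s hs
  · intro htail φ q
    have hφ : ∀ i, Measurable (φ i) := fun i =>
      (BSMD.monotone_ironedVirtualValue (BSMD.exists_revenueCurve_le (htail i))).measurable
    have hq : ∀ i, q i ∈ Icc (0 : ℝ) 1 := BSMD.myersonProb_mem J τ μ
    choose x q₁ q₂ hmix hconst hconc hext hline using fun i =>
      BSMD.exists_ironing_mixture (htail i) (hq i)
    refine ⟨x, q₁, q₂, hmix, hconst, hconc, fun σ hσ => ?_⟩
    have hx : ∀ i, x i ∈ Icc (0 : ℝ) 1 := fun i => (hmix i).1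
    have hq₁ : ∀ i, q₁ i ∈ Icc (0 : ℝ) 1 := fun i =>
      ⟨(hq i).1.trans (hmix i).2.2.2.1, (hmix i).2.2.2.2.1⟩
    have hq₂ : ∀ i, q₂ i ∈ Icc (0 : ℝ) 1 := fun i =>
      ⟨(hmix i).2.1, (hmix i).2.2.1.trans (hq i).2⟩
    have hprob : ∀ i, IsProbabilityMeasure (BSMD.priceLottery (μ i) (x i) (q₁ i) (q₂ i)) :=
      fun i => BSMD.isProbabilityMeasure_priceLottery (μ i) (hx i) (hq₁ i) (hq₂ i)
    let V : Fin n → ℝ := fun i =>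
      x i * BSMD.revenueCurve (μ i) (q₁ i) + (1 - x i) * BSMD.revenueCurve (μ i) (q₂ i)
    have hV : ∀ i, ENNReal.ofReal (V i / q i) * ENNReal.ofReal (q i) = ENNReal.ofReal (V i) := by
      intro i
      rw [← ENNReal.ofReal_mul' (hq i).1]
      -- At `q i = 0` the division returns `0`, which is harmless because both mixed probabilities
      -- are then `0` and `V i = R(0) = 0`.
      rcases eq_or_ne (q i) 0 with h | h
      · obtain ⟨h1, h2⟩ := hext i (Or.inl h)
        simp [V, h1, h2, h, BSMD.revenueCurve_zero]
      · rw [div_mul_cancel₀ _ h]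
    refine BSMD.myersonRevenue_le_two_mul_randomSpmRevenue J τ μ hμ hφ _ σ
      (fun i => ENNReal.ofReal (V i / q i)) (fun j k hjk => ENNReal.ofReal_le_ofReal (hσ hjk))
      (fun i => ?_) (fun i => ?_) (fun i => ?_)
    · rw [BSMD.lintegral_priceLottery_accept (μ i) (hx i) (hq₁ i) (hq₂ i),
        (hmix i).2.2.2.2.2]
    · exact (BSMD.lintegral_priceLottery_price (μ i) (hx i) (hq₁ i) (hq₂ i)).trans (hV i).symm
    · refine le_of_le_of_eq ?_ (hV i).symm
      by_cases hex : q i = 0 ∨ q i = 1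
      · obtain ⟨h1, h2⟩ := hext i hex
        have : V i = BSMD.revenueCurve (μ i) (q i) := by
          simp only [V, h1, h2]
          ring
        rw [this]
        exact BSMD.lintegral_paymentBound_le_of_extreme J τ μ hφ i hex
      · push Not at hex
        obtain ⟨s, hs⟩ := hline i (lt_of_le_of_ne (hq i).1 hex.1.symm)
          (lt_of_le_of_ne (hq i).2 hex.2)
        exact BSMD.lintegral_paymentBound_le_affine J τ μ hφ i _ s hs
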